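/- Let $\Gamma\subset SL(2,\mathbb{Z})$ be a subgroup of finite index, let $P\Gamma$ be its image in $PSL(2,\mathbb{Z})$, and let $K$ be a finite set of integers $k\ge 2$. For $k\in K$ let $Sh_k(\Gamma)$ be the space of one-forms on the upper half plane $H$ spanned by the forms $f(z)P(z,1)\,dz$, where $f$ is a cusp form of weight $k$ for $\Gamma$ and $P(X,Y)$ is a complex homogeneous polynomial of degree $k-2$. Put $Sh=\bigoplus_{k\in K}Sh_k(\Gamma)$. The group $\Gamma$ acts on $Sh$ by pull-back $\gamma^*$ of forms, and on the dual space $Sh^*$ by the adjoint maps $\gamma_*$. Let $(\omega_v)_{v\in V}$ be a finite basis of $Sh$ and $(A_v)_{v\in V}$ the dual basis of $Sh^*$; then $\gamma_*$ also acts on the ring $\mathbb{C}\langle\langle A_v\rangle\rangle$ of formal series in the associative noncommuting variables $A_v$, through the substitutions $A_v\mapsto\gamma_*A_v$. Put $\Omega=\sum_v A_v\omega_v$ and, for $a,b\in\mathbb{P}^1(\mathbb{Q})$, $$J_a^b(\Omega)=1+\sum_{n\ge1}\int_a^b\Omega(z_1)\int_a^{z_1}\Omega(z_2)\cdots\int_a^{z_{n-1}}\Omega(z_n)\in\mathbb{C}\langle\langle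 A_v\rangle\rangle ,$$ the integrals being taken along the hyperbolic geodesic from $a$ to $b$ (so $J_a^a(\Omega)=1$). Choose a set $C\subset PSL(2,\mathbb{Z})$ of representatives of $P\Gamma\backslash PSL(2,\mathbb{Z})$, so that every element of $PSL(2,\mathbb{Z})$ is $\gamma c$ for unique $\gamma\in P\Gamma$, $c\in C$, and call the series $\bigl(J_{c(i\infty)}^{c(0)}(\Omega)\bigr)^{\pm1}$, $c\in C$, the primitive integrals. Then all these iterated integrals converge absolutely, and for all $a,b\in\mathbb{P}^1(\mathbb{Q})$ the series $J_b^a(\Omega)$ is a noncommutative monomial (a finite ordered product) in elements $\gamma_*(y)$, where $\gamma$ runs over $\Gamma$ and $y$ over the primitive integrals. In particular this holds for the components $J_{\gamma a}^a(\Omega)$, $\gamma\in\Gamma$, of the Shimura cocycle with initial point a cusp $a$. -/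

import Mathlib

open scoped UpperHalfPlane MatrixGroups OnePoint DirectSum

noncomputable section

namespace ManinShimura

/-! ### The spaces of one-forms and the action of `Γ` on them

A holomorphic one-form `h(z) dz` on the upper half plane is represented by its coefficient
`h : ℍ → ℂ`. -/

/-- The pull-back `g^*` of one-forms: `h(z) dz ↦ h(gz) d(gz) = h(gz) (cz+d)⁻² dz`, for
`g ∈ SL(2, ℤ)` with lower row `(c, d)`. -/
def formPullback (g : SL(2, ℤ)) : (ℍ → ℂ) →ₗ[ℂ] (ℍ → ℂ) where
  toFun h z := h (g • z) * (((g 1 0 : ℤ) : ℂ) * (z : ℂ) + ((g 1 1 : ℤ) : ℂ)) ^ (-2 : ℤ)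
  map_add' h₁ h₂ := by
    funext z
    simp only [Pi.add_apply]
    ring
  map_smul' c h := by
    funext z
    simp only [Pi.smul_apply, smul_eq_mul, RingHom.id_apply]
    ring

/-- The space `Sh_k(Γ)`, spanned by the forms `f(z) P(z,1) dz`, where `f` is a cusp form of
weight `k` for `Γ` and `P` is a homogeneous polynomial of degree `k - 2` in two variables. -/
def shimuraForms (Γ : Subgroup SL(2, ℤ)) (k : ℕ) : Submodule ℂ (ℍ → ℂ) :=
  Submodule.span ℂ {h | ∃ (f : CuspForm (Γ : Subgroup (GL (Fin 2) ℝ)) (k : ℤ))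
    (P : MvPolynomial (Fin 2) ℂ), P.IsHomogeneous (k - 2) ∧
      h = fun z : ℍ => f z * MvPolynomial.eval ![(z : ℂ), 1] P}

theorem eval_mul_of_isHomogeneous {P : MvPolynomial (Fin 2) ℂ} {n : ℕ} (hP : P.IsHomogeneous n)
    (c : ℂ) (x : Fin 2 → ℂ) :
    MvPolynomial.eval (fun i => c * x i) P = c ^ n * MvPolynomial.eval x P := by
  rw [MvPolynomial.eval_eq, MvPolynomial.eval_eq, Finset.mul_sum]
  refine Finset.sum_congr rfl fun d hd => ?_
  have hdeg : ∑ i ∈ d.support, d i = n := by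
    have h := hP (MvPolynomial.mem_support_iff.mp hd)
    simpa [Finsupp.weight_apply, Finsupp.sum] using h
  simp_rw [mul_pow, Finset.prod_mul_distrib, Finset.prod_pow_eq_pow_sum, hdeg]
  ring

/-- `Sh_k(Γ)` is stable under `Γ`. -/
theorem formPullback_mem (Γ : Subgroup SL(2, ℤ)) {k : ℕ} (hk : 2 ≤ k) (g : Γ) :
    ∀ h ∈ shimuraForms Γ k, formPullback (g : SL(2, ℤ)) h ∈ shimuraForms Γ k := by
  intro h hh
  induction hh using Submodule.span_induction with
  | zero => simp
  | add x y _ _ hx hy => rw [map_add]; exact Submodule.add_mem _ hx hy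
  | smul a x _ hx => rw [map_smul]; exact Submodule.smul_mem _ _ hx
  | mem x hx =>
    obtain ⟨f, P, hP, rfl⟩ := hx
    refine Submodule.subset_span ⟨f, MvPolynomial.aeval
      ![MvPolynomial.C (((g : SL(2, ℤ)) 0 0 : ℤ) : ℂ) * MvPolynomial.X 0 +
          MvPolynomial.C (((g : SL(2, ℤ)) 0 1 : ℤ) : ℂ) * MvPolynomial.X 1,
        MvPolynomial.C (((g : SL(2, ℤ)) 1 0 : ℤ) : ℂ) * MvPolynomial.X 0 +
          MvPolynomial.C (((g : SL(2, ℤ)) 1 1 : ℤ) : ℂ) * MvPolynomial.X 1] P, ?_, ?_⟩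
    · have := hP.aeval (n := 1) ![MvPolynomial.C (((g : SL(2, ℤ)) 0 0 : ℤ) : ℂ) *
            (MvPolynomial.X 0 : MvPolynomial (Fin 2) ℂ) +
          MvPolynomial.C (((g : SL(2, ℤ)) 0 1 : ℤ) : ℂ) * MvPolynomial.X 1,
        MvPolynomial.C (((g : SL(2, ℤ)) 1 0 : ℤ) : ℂ) * MvPolynomial.X 0 +
          MvPolynomial.C (((g : SL(2, ℤ)) 1 1 : ℤ) : ℂ) * MvPolynomial.X 1] ?_
      · rwa [one_mul] at this
      · intro i
        fin_cases i <;>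
        exact ((MvPolynomial.isHomogeneous_C_mul_X _ _).add
          (MvPolynomial.isHomogeneous_C_mul_X _ _))
    · funext z
      have hf := SlashInvariantForm.slash_action_eqn_SL'' f g.2 z
      have hd := UpperHalfPlane.denom_ne_zero (Matrix.SpecialLinearGroup.toGL
        ((Matrix.SpecialLinearGroup.map (Int.castRingHom ℝ)) (g : SL(2, ℤ)))) z
      rw [ModularGroup.denom_apply] at hf hd
      have hz : (((g : SL(2, ℤ)) • z : ℍ) : ℂ) =
          ((((g : SL(2, ℤ)) 0 0 : ℤ) : ℂ) * z + (((g : SL(2, ℤ)) 0 1 : ℤ) : ℂ)) /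
          ((((g : SL(2, ℤ)) 1 0 : ℤ) : ℂ) * z + (((g : SL(2, ℤ)) 1 1 : ℤ) : ℂ)) := by
        rw [UpperHalfPlane.coe_specialLinearGroup_apply]
        simp
      simp only [formPullback, LinearMap.coe_mk, AddHom.coe_mk]
      have key := eval_mul_of_isHomogeneous hP
        ((((g : SL(2, ℤ)) 1 0 : ℤ) : ℂ) * z + (((g : SL(2, ℤ)) 1 1 : ℤ) : ℂ))
        ![(((g : SL(2, ℤ)) • z : ℍ) : ℂ), 1]
      have hev : ∀ q : Fin 2 → MvPolynomial (Fin 2) ℂ,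
          MvPolynomial.eval ![(z : ℂ), 1] (MvPolynomial.aeval q P) =
          MvPolynomial.eval (fun i => MvPolynomial.eval ![(z : ℂ), 1] (q i)) P := by
        intro q
        have := MvPolynomial.comp_aeval_apply q (MvPolynomial.aeval (R := ℂ) ![(z : ℂ), 1]) P
        simpa only [MvPolynomial.coe_aeval_eq_eval, RingHom.coe_coe,
          MvPolynomial.aeval_eq_eval] using this
      have hvec : (fun i => MvPolynomial.eval ![(z : ℂ), 1]
          ((![MvPolynomial.C (((g : SL(2, ℤ)) 0 0 : ℤ) : ℂ) * MvPolynomial.X 0 +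
            MvPolynomial.C (((g : SL(2, ℤ)) 0 1 : ℤ) : ℂ) * MvPolynomial.X 1,
          MvPolynomial.C (((g : SL(2, ℤ)) 1 0 : ℤ) : ℂ) * MvPolynomial.X 0 +
            MvPolynomial.C (((g : SL(2, ℤ)) 1 1 : ℤ) : ℂ) * MvPolynomial.X 1] :
              Fin 2 → MvPolynomial (Fin 2) ℂ) i)) =
          fun i => ((((g : SL(2, ℤ)) 1 0 : ℤ) : ℂ) * z + (((g : SL(2, ℤ)) 1 1 : ℤ) : ℂ)) *
            ![(((g : SL(2, ℤ)) • z : ℍ) : ℂ), 1] i := by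
        funext i
        fin_cases i
        · simp only [hz]
          simp [mul_div_cancel₀ _ hd]
        · simp
      rw [hev, hvec, key, hf, ← zpow_natCast _ (k - 2), Nat.cast_sub hk]
      generalize ((((g : SL(2, ℤ)) 1 0 : ℤ) : ℂ) * z + (((g : SL(2, ℤ)) 1 1 : ℤ) : ℂ)) = j at *
      rw [zpow_sub₀ hd, zpow_neg]
      push_cast
      ring

/-- The space `Sh_K = ⨁_{k ∈ K} Sh_k(Γ)` attached to a finite set `K` of weights. -/
abbrev ShimuraSpace (Γ : Subgroup SL(2, ℤ)) (K : Finset ℕ) : Type :=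
  ⨁ k : K, shimuraForms Γ (k : ℕ)

/-- The one-form given by an element of `Sh_K`. -/
def toForm (Γ : Subgroup SL(2, ℤ)) (K : Finset ℕ) : ShimuraSpace Γ K →ₗ[ℂ] (ℍ → ℂ) :=
  DirectSum.coeLinearMap fun k : K => shimuraForms Γ (k : ℕ)

/-- The action `γ^*` of `γ ∈ Γ` on `Sh_K` by pull-back of one-forms. -/
def pullback (Γ : Subgroup SL(2, ℤ)) (K : Finset ℕ) (hK : ∀ k ∈ K, 2 ≤ k) (γ : Γ) :
    ShimuraSpace Γ K →ₗ[ℂ] ShimuraSpace Γ K :=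
  DirectSum.lmap fun k : K =>
    (formPullback (γ : SL(2, ℤ))).restrict (formPullback_mem Γ (hK k k.2) γ)

/-- The adjoint action `γ_*` of `γ ∈ Γ` on the dual space of `Sh_K`. -/
def pushforward (Γ : Subgroup SL(2, ℤ)) (K : Finset ℕ) (hK : ∀ k ∈ K, 2 ≤ k) (γ : Γ) :
    Module.Dual ℂ (ShimuraSpace Γ K) →ₗ[ℂ] Module.Dual ℂ (ShimuraSpace Γ K) :=
  (pullback Γ K hK γ).dualMap

/-! ### Formal series in noncommuting variables -/

/-- The ring `ℂ⟨⟨A_v⟩⟩` of formal series in the associative noncommuting variables `A_v`,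
`v ∈ V`: a series is the family of its coefficients at the words `A_{v₁} ⋯ A_{vₙ}`. -/
def NCSeries (V : Type*) : Type _ := List V → ℂ

namespace NCSeries

variable {V : Type*}

instance : AddCommGroup (NCSeries V) := inferInstanceAs (AddCommGroup (List V → ℂ))

instance : One (NCSeries V) where
  one w := match w with
    | [] => 1
    | _ :: _ => 0

/-- Concatenation product: sum over all ways to cut a word into two pieces. -/
instance : Mul (NCSeries V) where
  mul F G w := ∑ i ∈ Finset.range (w.length + 1), F (w.take i) * G (w.drop i)

theorem one_nil : (1 : NCSeries V) [] = 1 := rfl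

theorem one_cons (v : V) (w : List V) : (1 : NCSeries V) (v :: w) = 0 := rfl

theorem mul_apply (F G : NCSeries V) (w : List V) :
    (F * G) w = ∑ i ∈ Finset.range (w.length + 1), F (w.take i) * G (w.drop i) := rfl

theorem add_apply (F G : NCSeries V) (w : List V) : (F + G) w = F w + G w := rfl

theorem zero_apply (w : List V) : (0 : NCSeries V) w = 0 := rfl

theorem mul_nil (F G : NCSeries V) : (F * G) [] = F [] * G [] := by
  simp [mul_apply]

/-- The series of the coefficients of `F` at the words that begin with `v`. -/
def tail (F : NCSeries V) (v : V) : NCSeries V := fun w => F (v :: w)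

/-- Multiplication by a constant. -/
def cmul (c : ℂ) (F : NCSeries V) : NCSeries V := fun w => c * F w

theorem mul_cons (F G : NCSeries V) (v : V) (w : List V) :
    (F * G) (v :: w) = F [] * G (v :: w) + (tail F v * G) w := by
  rw [mul_apply, mul_apply, List.length_cons, Finset.sum_range_succ']
  simp [add_comm, tail]

protected theorem add_mul' (F G H : NCSeries V) : (F + G) * H = F * H + G * H := by
  funext w
  simp only [mul_apply, add_apply, add_mul, Finset.sum_add_distrib]

theorem const_mul' (c : ℂ) (F G : NCSeries V) (w : List V) :
    (cmul c F * G) w = c * (F * G) w := by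
  simp only [mul_apply, cmul, Finset.mul_sum, mul_assoc]

protected theorem mul_assoc' (F G H : NCSeries V) : F * G * H = F * (G * H) := by
  funext w
  induction w generalizing F with
  | nil => simp only [mul_nil, mul_assoc]
  | cons v w ih =>
    have h : tail (F * G) v = cmul (F []) (tail G v) + tail F v * G := by
      funext u
      exact mul_cons F G v u
    rw [mul_cons, mul_cons, h, NCSeries.add_mul', add_apply, ih, mul_nil, mul_cons G H v w,
      const_mul' (F []) (tail G v) H w]
    ring

protected theorem one_mul' (F : NCSeries V) : 1 * F = F := by
  funext w
  cases w with
  | nil => simp [mul_nil, one_nil]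
  | cons v w =>
    have h : tail (1 : NCSeries V) v = 0 := rfl
    rw [mul_cons, h, one_nil, one_mul, mul_apply]
    simp [zero_apply]

protected theorem mul_one' (F : NCSeries V) : F * 1 = F := by
  funext w
  induction w generalizing F with
  | nil => simp [mul_nil, one_nil]
  | cons v w ih => rw [mul_cons, ih, one_cons, mul_zero, zero_add, tail]

instance : Ring (NCSeries V) :=
  { (inferInstance : AddCommGroup (NCSeries V)), (inferInstance : One (NCSeries V)),
    (inferInstance : Mul (NCSeries V)) with
    left_distrib := fun F G H => by
      funext w
      simp only [mul_apply, add_apply, mul_add, Finset.sum_add_distrib]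
    right_distrib := NCSeries.add_mul'
    zero_mul := fun F => by
      funext w
      simp [mul_apply, zero_apply]
    mul_zero := fun F => by
      funext w
      simp [mul_apply, zero_apply]
    mul_assoc := NCSeries.mul_assoc'
    one_mul := NCSeries.one_mul'
    mul_one := NCSeries.mul_one' }

/-- The continuous substitution `A_v ↦ ∑_w L v w • A_w` in formal series: in the image of `F`
the coefficient of `A_{w₁} ⋯ A_{wₙ}` is the sum of `F(u₁ ⋯ uₙ) L(u₁, w₁) ⋯ L(uₙ, wₙ)` over all
words `u₁ ⋯ uₙ`. -/
def subst [Fintype V] (L : V → V → ℂ) (F : NCSeries V) : NCSeries V :=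
  fun w => ∑ u : Fin w.length → V, F (List.ofFn u) * ∏ i, L (u i) (w.get i)

end NCSeries

/-- The action `γ_*` of `γ ∈ Γ` on the ring of formal series `ℂ⟨⟨A_v⟩⟩`, where `(A_v)` is the
basis of the dual space of `Sh_K` that is dual to `(ω_v)`: the substitution
`A_v ↦ γ_* A_v = ∑_w ⟨ω_w, γ_* A_v⟩ A_w`. -/
def seriesAction {Γ : Subgroup SL(2, ℤ)} {K : Finset ℕ} (hK : ∀ k ∈ K, 2 ≤ k) {V : Type*}
    [Fintype V] (ω : Module.Basis V ℂ (ShimuraSpace Γ K)) (γ : Γ) :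
    NCSeries V → NCSeries V :=
  NCSeries.subst fun v w => pushforward Γ K hK γ (ω.coord v) (ω w)

/-! ### Iterated integrals between cusps -/

/-- The hyperbolic geodesic from the cusp `a` to the cusp `b`, parametrised by arc length: a
vertical half-line if one of them is `∞`, and otherwise the half-circle with diameter `[a, b]`.
(If `a = b` the path is constant.) -/
def geodesic : OnePoint ℚ → OnePoint ℚ → ℝ → ℂ
  | OnePoint.infty, OnePoint.infty, _ => 0
  | OnePoint.infty, OnePoint.some y, t => (y : ℂ) + Real.exp (-t) * Complex.I
  | OnePoint.some x, OnePoint.infty, t => (x : ℂ) + Real.exp t * Complex.I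
  | OnePoint.some x, OnePoint.some y, t =>
      ((x : ℂ) + y) / 2 + ((y : ℂ) - x) / 2 * Real.tanh t +
        |(y : ℝ) - x| / (2 * Real.cosh t) * Complex.I

theorem geodesic_im_pos {a b : OnePoint ℚ} (hab : a ≠ b) (t : ℝ) : 0 < (geodesic a b t).im := by
  match a, b, hab with
  | OnePoint.infty, OnePoint.infty, h => exact absurd rfl h
  | OnePoint.infty, OnePoint.some y, _ =>
    simp only [geodesic, ← Complex.ofReal_ratCast, Complex.add_im, Complex.ofReal_im,
      Complex.im_ofReal_mul, Complex.I_im]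
    positivity
  | OnePoint.some x, OnePoint.infty, _ =>
    simp only [geodesic, ← Complex.ofReal_ratCast, Complex.add_im, Complex.ofReal_im,
      Complex.im_ofReal_mul, Complex.I_im]
    positivity
  | OnePoint.some x, OnePoint.some y, h =>
    have hxy : (y : ℝ) - x ≠ 0 := fun e => h (by
      rw [sub_eq_zero] at e
      rw [Rat.cast_injective e])
    have e : geodesic (OnePoint.some x) (OnePoint.some y) t =
        ((((x : ℝ) + y) / 2 + ((y : ℝ) - x) / 2 * Real.tanh t : ℝ) : ℂ) +
          ((|(y : ℝ) - x| / (2 * Real.cosh t) : ℝ) : ℂ) * Complex.I := by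
      simp [geodesic]
    rw [e, Complex.add_im, Complex.ofReal_im, Complex.im_ofReal_mul, Complex.I_im]
    have := abs_pos.mpr hxy
    have := Real.cosh_pos t
    simp only [zero_add, mul_one]
    positivity

/-- The integrand of the one-form `h(z) dz` along a path `p` (in the upper half plane). -/
def alongPath (p : ℝ → ℂ) (h : ℍ → ℂ) (s : ℝ) : ℂ :=
  h (UpperHalfPlane.ofComplex (p s)) * deriv p s

/-- The iterated integral `∫_a^{p(t)} ω_{v₁}(z₁) ∫_a^{z₁} ω_{v₂}(z₂) ⋯ ∫_a^{z_{n-1}} ω_{vₙ}(zₙ)`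
along the path `p`, which starts at `a` at time `-∞`. -/
def iterInt {V : Type*} (p : ℝ → ℂ) (ω : V → ℍ → ℂ) : List V → ℝ → ℂ
  | [], _ => 1
  | v :: w, t => ∫ s in Set.Iic t, alongPath p (ω v) s * iterInt p ω w s

/-- The same along the whole path. -/
def iterIntFull {V : Type*} (p : ℝ → ℂ) (ω : V → ℍ → ℂ) : List V → ℂ
  | [] => 1
  | v :: w => ∫ s, alongPath p (ω v) s * iterInt p ω w s

/-- Absolute convergence of all the integrals that occur in the previous definition. -/
def IterConverges {V : Type*} (p : ℝ → ℂ) (ω : V → ℍ → ℂ) : Prop :=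
  ∀ (v : V) (w : List V),
    MeasureTheory.Integrable fun s => alongPath p (ω v) s * iterInt p ω w s

/-- The coefficient functions of the one-forms of a basis `(ω_v)` of `Sh_K`. -/
def basisForms {Γ : Subgroup SL(2, ℤ)} {K : Finset ℕ} {V : Type*}
    (ω : Module.Basis V ℂ (ShimuraSpace Γ K)) (v : V) : ℍ → ℂ :=
  toForm Γ K (ω v)

/-- The iterated Shimura integral `J_a^b(Ω)`, `Ω = ∑_v A_v ω_v`, from the cusp `a` to the
cusp `b`, as a formal series in the noncommuting variables `A_v`. -/
def J {Γ : Subgroup SL(2, ℤ)} {K : Finset ℕ} {V : Type*}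
    (ω : Module.Basis V ℂ (ShimuraSpace Γ K)) (a b : OnePoint ℚ) : NCSeries V :=
  iterIntFull (geodesic a b) (basisForms ω)

/-! ### Primitive integrals -/

/-- The cusp `g(c)`, for `g ∈ SL(2, ℤ)`, under fractional linear transformations of `ℙ¹(ℚ)`. -/
def cuspAct (g : SL(2, ℤ)) (c : OnePoint ℚ) : OnePoint ℚ :=
  Matrix.SpecialLinearGroup.mapGL ℚ g • c

/-- The image `PΓ` of `Γ` in `PSL(2, ℤ)`. -/
def projImage (Γ : Subgroup SL(2, ℤ)) :
    Subgroup (Matrix.ProjectiveSpecialLinearGroup (Fin 2) ℤ) :=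
  Γ.map (QuotientGroup.mk' (Subgroup.center SL(2, ℤ)))

/-- `C` is a set of representatives of `PΓ \ PSL(2, ℤ)`: every element of `PSL(2, ℤ)` is `γ c`
for unique `γ ∈ PΓ` and `c ∈ C`. -/
def IsRepresentatives (Γ : Subgroup SL(2, ℤ))
    (C : Set (Matrix.ProjectiveSpecialLinearGroup (Fin 2) ℤ)) : Prop :=
  Subgroup.IsComplement (projImage Γ : Set (Matrix.ProjectiveSpecialLinearGroup (Fin 2) ℤ)) C

/-- The primitive integrals `(J_{c(i∞)}^{c(0)})^{±1}`, `c ∈ C`. -/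
def IsPrimitive {Γ : Subgroup SL(2, ℤ)} {K : Finset ℕ} {V : Type*}
    (ω : Module.Basis V ℂ (ShimuraSpace Γ K))
    (C : Set (Matrix.ProjectiveSpecialLinearGroup (Fin 2) ℤ)) (x : NCSeries V) : Prop :=
  ∃ g : SL(2, ℤ), QuotientGroup.mk' (Subgroup.center SL(2, ℤ)) g ∈ C ∧
    (x = J ω (cuspAct g OnePoint.infty) (cuspAct g ((0 : ℚ) : OnePoint ℚ)) ∨
      (x * J ω (cuspAct g OnePoint.infty) (cuspAct g ((0 : ℚ) : OnePoint ℚ)) = 1 ∧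
        J ω (cuspAct g OnePoint.infty) (cuspAct g ((0 : ℚ) : OnePoint ℚ)) * x = 1))

/-- `x` is a noncommutative monomial, that is a finite ordered product, in elements `γ_*(y)`
with `γ ∈ Γ` and `y` a primitive integral. -/
def IsPrimitiveMonomial {Γ : Subgroup SL(2, ℤ)} {K : Finset ℕ} (hK : ∀ k ∈ K, 2 ≤ k)
    {V : Type*} [Fintype V] (ω : Module.Basis V ℂ (ShimuraSpace Γ K))
    (C : Set (Matrix.ProjectiveSpecialLinearGroup (Fin 2) ℤ)) (x : NCSeries V) : Prop :=
  ∃ l : List (NCSeries V),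
    (∀ z ∈ l, ∃ (γ : Γ) (y : NCSeries V), IsPrimitive ω C y ∧ z = seriesAction hK ω γ y) ∧
      x = l.prod

end ManinShimura

end

noncomputable section

namespace ManinShimura

open Filter Topology

/-! The series `J` is treated as parallel transport for the equation dF = ΩF. A solution with
constant term 1 is built word by word, each coefficient being a primitive of a form times the
coefficient of a shorter word, and it is determined by its value at one point. Since Ω multiplies on
the left, any two solutions differ by a constant factor on the right (`IsSolution.exists_eq_mul`).

Cusp forms decay exponentially at every cusp and the polynomial factors grow only polynomially, so
for each cusp there is a solution with limit 1 there (`exists_isSolution_limAt`). The constant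
relating the solutions normalised at a and at b is the iterated integral from a to b
(`eq_mul_geodesicSeries`). Comparing such solutions gives both properties of J that are needed:
composition, J_a^c = J_b^c J_a^b, and equivariance, J_{γa}^{γb} = γ_* J_a^b, the latter because γ^*Ω
= γ_*Ω.

What remains is Manin's continued fraction argument. Any two cusps are g∞ and gh∞ with h a word in S
and T. As T fixes ∞ and S∞ = 0, the word yields a chain of cusps whose consecutive members coincide
or are g'∞ and g'0 in some order. A coset decomposition of g' in PSL(2, ℤ) turns each edge into γ_*
of a primitive integral. A reversed edge is the edge of g'S, so exponent +1 always suffices. -/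

/-! ### Right inverses and limits of formal series -/

namespace NCSeries

variable {V : Type*}

/-- The coefficients of the right inverse of a series with constant term `1`. -/
def rightInvCoeff (G : NCSeries V) : List V → ℂ
  | [] => 1
  | v :: w => -∑ i ∈ Finset.range (w.length + 1), G (v :: w.take i) * rightInvCoeff G (w.drop i)
  termination_by w => w.length
  decreasing_by simp

/-- The right inverse of a series with constant term `1`. -/
def rightInv (G : NCSeries V) : NCSeries V := rightInvCoeff G

theorem rightInv_nil (G : NCSeries V) : rightInv G [] = 1 := by
  rw [rightInv, rightInvCoeff]

theorem rightInv_cons (G : NCSeries V) (v : V) (w : List V) :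
    rightInv G (v :: w) = -(tail G v * rightInv G) w := by
  rw [rightInv, rightInvCoeff]
  rfl

theorem mul_rightInv {G : NCSeries V} (hG : G [] = 1) : G * rightInv G = 1 := by
  funext w
  cases w with
  | nil => simp [mul_nil, hG, one_nil, rightInv_nil]
  | cons v w => rw [mul_cons, hG, one_cons, rightInv_cons]; ring

theorem tendsto_mul_const {ι : Type*} {l : Filter ι} {F : ι → NCSeries V} {A : NCSeries V}
    (hF : ∀ w, Tendsto (fun i => F i w) l (𝓝 (A w))) (C : NCSeries V) (w : List V) :
    Tendsto (fun i => (F i * C) w) l (𝓝 ((A * C) w)) := by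
  simp only [mul_apply]
  exact tendsto_finsetSum _ fun i _ => (hF _).mul_const _

theorem subst_nil [Fintype V] (L : V → V → ℂ) (F : NCSeries V) : subst L F [] = F [] := by
  simp [subst]

/-- Splitting off the first letter matches the recursion on words in dF = ΩF, so that substitution
can be carried through the differential equation. -/
theorem subst_cons [Fintype V] (L : V → V → ℂ) (F : NCSeries V) (v : V) (w : List V) :
    subst L F (v :: w) = ∑ u, L u v * subst L (tail F u) w := by
  refine ((Fin.consEquiv fun _ : Fin (w.length + 1) => V).sum_comp fun u =>
    (F (List.ofFn u) * ∏ i : Fin (w.length + 1), L (u i) ((v :: w).get i) : ℂ)).symm.trans ?_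
  rw [Fintype.sum_prod_type]
  refine Finset.sum_congr rfl fun u _ => ?_
  rw [subst, Finset.mul_sum]
  refine Finset.sum_congr rfl fun f _ => ?_
  rw [Fin.prod_univ_succ]
  simp only [Fin.consEquiv, Equiv.coe_fn_mk, tail, List.ofFn_cons, Fin.cons_zero, Fin.cons_succ,
    List.get_cons_zero, List.get_cons_succ']
  ring

theorem subst_one [Fintype V] (L : V → V → ℂ) : subst L (1 : NCSeries V) = 1 := by
  funext w
  cases w with
  | nil => rw [subst_nil]
  | cons v w =>
    rw [subst_cons, one_cons]
    refine Finset.sum_eq_zero fun u _ => ?_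
    have : tail (1 : NCSeries V) u = 0 := rfl
    simp [this, subst, zero_apply]

theorem tendsto_subst [Fintype V] {ι : Type*} {l : Filter ι} {F : ι → NCSeries V}
    {A : NCSeries V} (hF : ∀ w, Tendsto (fun i => F i w) l (𝓝 (A w))) (L : V → V → ℂ)
    (w : List V) : Tendsto (fun i => subst L (F i) w) l (𝓝 (subst L A w)) :=
  tendsto_finsetSum _ fun _ _ => (hF _).mul_const _

end NCSeries

/-! ### Fractional linear transformations -/

/-- The fractional linear transformation of `ℂ` given by `g`. -/
def mob (g : SL(2, ℤ)) (z : ℂ) : ℂ :=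
  (((g 0 0 : ℤ) : ℂ) * z + ((g 0 1 : ℤ) : ℂ)) / (((g 1 0 : ℤ) : ℂ) * z + ((g 1 1 : ℤ) : ℂ))

theorem denom_ne_zero (g : SL(2, ℤ)) {z : ℂ} (hz : 0 < z.im) :
    ((g 1 0 : ℤ) : ℂ) * z + ((g 1 1 : ℤ) : ℂ) ≠ 0 := by
  have h := UpperHalfPlane.denom_ne_zero (Matrix.SpecialLinearGroup.toGL
    ((Matrix.SpecialLinearGroup.map (Int.castRingHom ℝ)) g)) ⟨z, hz⟩
  rwa [ModularGroup.denom_apply] at h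

theorem coe_smul_eq_mob (g : SL(2, ℤ)) (z : ℍ) : ((g • z : ℍ) : ℂ) = mob g z := by
  rw [UpperHalfPlane.coe_specialLinearGroup_apply]
  simp [mob]

theorem mob_im_pos (g : SL(2, ℤ)) {z : ℂ} (hz : 0 < z.im) : 0 < (mob g z).im := by
  have := (g • (⟨z, hz⟩ : ℍ)).im_pos
  rwa [← UpperHalfPlane.coe_im, coe_smul_eq_mob] at this

theorem ofComplex_mob (g : SL(2, ℤ)) {z : ℂ} (hz : 0 < z.im) :
    UpperHalfPlane.ofComplex (mob g z) = g • UpperHalfPlane.ofComplex z := by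
  have h : mob g z = ((g • (⟨z, hz⟩ : ℍ) : ℍ) : ℂ) := by rw [coe_smul_eq_mob]
  rw [h, UpperHalfPlane.ofComplex_apply, UpperHalfPlane.ofComplex_apply_of_im_pos hz]

theorem coe_ofComplex {z : ℂ} (hz : 0 < z.im) : (UpperHalfPlane.ofComplex z : ℂ) = z := by
  rw [UpperHalfPlane.ofComplex_apply_of_im_pos hz]

theorem mob_mul (g h : SL(2, ℤ)) {z : ℂ} (hz : 0 < z.im) : mob (g * h) z = mob g (mob h z) := by
  have := coe_smul_eq_mob (g * h) ⟨z, hz⟩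
  rw [mul_smul, coe_smul_eq_mob, coe_smul_eq_mob] at this
  exact this.symm

theorem mob_one (z : ℂ) : mob 1 z = z := by
  simp [mob]

/-- The quotient rule leaves the determinant, which is 1, over the squared denominator; this is the
factor in `formPullback`. -/
theorem hasDerivAt_mob (g : SL(2, ℤ)) {z : ℂ} (hz : 0 < z.im) :
    HasDerivAt (mob g) ((((g 1 0 : ℤ) : ℂ) * z + ((g 1 1 : ℤ) : ℂ)) ^ (-2 : ℤ)) z := by
  have hd := denom_ne_zero g hz
  have hdet : ((g 0 0 : ℤ) : ℂ) * ((g 1 1 : ℤ) : ℂ) - ((g 0 1 : ℤ) : ℂ) * ((g 1 0 : ℤ) : ℂ) = 1 := by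
    have := g.det_coe
    rw [Matrix.det_fin_two] at this
    exact_mod_cast this
  have h1 := ((hasDerivAt_id z).const_mul ((g 0 0 : ℤ) : ℂ)).add_const ((g 0 1 : ℤ) : ℂ)
  have h2 := ((hasDerivAt_id z).const_mul ((g 1 0 : ℤ) : ℂ)).add_const ((g 1 1 : ℤ) : ℂ)
  refine (h1.div h2 hd).congr_deriv ?_
  simp only [id, mul_one]
  rw [zpow_neg, eq_comm, inv_eq_one_div]
  congr 1
  linear_combination -hdet

theorem formPullback_apply (g : SL(2, ℤ)) (h : ℍ → ℂ) (z : ℍ) :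
    formPullback g h z =
      h (g • z) * (((g 1 0 : ℤ) : ℂ) * (z : ℂ) + ((g 1 1 : ℤ) : ℂ)) ^ (-2 : ℤ) := rfl

/-- This is the cocycle identity for the automorphy factor cz + d. -/
theorem formPullback_mul (g g' : SL(2, ℤ)) (h : ℍ → ℂ) :
    formPullback (g * g') h = formPullback g' (formPullback g h) := by
  funext z
  simp only [formPullback_apply, mul_smul, mul_assoc]
  rw [← mul_zpow]
  congr 2
  rw [coe_smul_eq_mob, mob]
  have hd := denom_ne_zero g' z.im_pos
  rw [UpperHalfPlane.coe] at *
  simp only [Matrix.SpecialLinearGroup.coe_mul, Matrix.mul_apply, Fin.sum_univ_two]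
  push_cast
  field_simp
  ring

theorem formPullback_one (h : ℍ → ℂ) : formPullback 1 h = h := by
  funext z
  simp [formPullback_apply]

/-! ### The action on cusps -/

theorem cuspAct_mul (g h : SL(2, ℤ)) (c : OnePoint ℚ) :
    cuspAct (g * h) c = cuspAct g (cuspAct h c) := by
  simp [cuspAct, mul_smul]

theorem cuspAct_inv_eq_iff {g : SL(2, ℤ)} {a b : OnePoint ℚ} :
    cuspAct g⁻¹ a = b ↔ a = cuspAct g b := by
  simp [cuspAct, inv_smul_eq_iff]

theorem exists_cuspAct_infty (c : OnePoint ℚ) : ∃ g : SL(2, ℤ), cuspAct g ∞ = c :=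
  OnePoint.exists_mem_SL2 ℤ c

theorem cuspAct_infty (g : SL(2, ℤ)) :
    cuspAct g ∞ = if (g 1 0 : ℤ) = 0 then ∞ else (((g 0 0 : ℤ) : ℚ) / ((g 1 0 : ℤ) : ℚ) : ℚ) := by
  simp [cuspAct, OnePoint.smul_infty_eq_ite]

/-- Central matrices are scalar. Hence lifting an element of PSL(2, ℤ) to SL(2, ℤ) does not affect
its action on cusps. -/
theorem cuspAct_of_mem_center {g : SL(2, ℤ)} (hg : g ∈ Subgroup.center SL(2, ℤ))
    (c : OnePoint ℚ) : cuspAct g c = c := by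
  obtain ⟨r, hr, h⟩ := Matrix.SpecialLinearGroup.mem_center_iff.mp hg
  have h0 : r ≠ 0 := by rintro rfl; simp at hr
  have e : ∀ i j, (g i j : ℤ) = if i = j then r else 0 := fun i j => by
    rw [← h, Matrix.scalar_apply, Matrix.diagonal_apply]
  cases c with
  | infty => rw [cuspAct_infty]; simp [e]
  | coe x => simp [cuspAct, OnePoint.smul_some_eq_ite, e, h0]

theorem cuspAct_S_infty : cuspAct ModularGroup.S ∞ = ((0 : ℚ) : OnePoint ℚ) := by
  rw [cuspAct_infty]
  simp [ModularGroup.S]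

theorem cuspAct_T_infty : cuspAct ModularGroup.T ∞ = ∞ := by
  rw [cuspAct_infty]
  simp [ModularGroup.T]

theorem cuspAct_S_zero : cuspAct ModularGroup.S ((0 : ℚ) : OnePoint ℚ) = ∞ := by
  rw [← cuspAct_S_infty, ← cuspAct_mul, cuspAct_infty, if_pos (by decide)]

/-! ### Generating series of iterated primitives -/

variable {V : Type*}

/-- `F` is a series of functions on the upper half plane with constant term `1` that satisfies
`dF = Ω F`, where `Ω = ∑ A_v ω_v`. -/
structure IsSolution (ω : V → ℍ → ℂ) (F : ℂ → NCSeries V) : Prop where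
  nil : ∀ z, 0 < z.im → F z [] = 1
  cons : ∀ z, 0 < z.im → ∀ v w, HasDerivAt (fun z => F z (v :: w))
    (ω v (UpperHalfPlane.ofComplex z) * F z w) z

theorem eventually_im_pos {z : ℂ} (hz : 0 < z.im) : ∀ᶠ u in 𝓝 z, 0 < u.im :=
  (isOpen_lt continuous_const Complex.continuous_im).mem_nhds hz

theorem eq_of_hasDerivAt_eq {f g f' : ℂ → ℂ} (hf : ∀ z, 0 < z.im → HasDerivAt f (f' z) z)
    (hg : ∀ z, 0 < z.im → HasDerivAt g (f' z) z) {z₀ : ℂ} (hz₀ : 0 < z₀.im) (h : f z₀ = g z₀)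
    {z : ℂ} (hz : 0 < z.im) : f z = g z := by
  have hs : IsOpen {z : ℂ | 0 < z.im} := isOpen_lt continuous_const Complex.continuous_im
  have hc : IsPreconnected {z : ℂ | 0 < z.im} := (convex_halfSpace_im_gt 0).isPreconnected
  refine hs.eqOn_of_deriv_eq hc
    (fun u hu => (hf u hu).differentiableAt.differentiableWithinAt)
    (fun u hu => (hg u hu).differentiableAt.differentiableWithinAt)
    (fun u hu => ?_) hz₀ h hz
  rw [(hf u hu).deriv, (hg u hu).deriv]

namespace IsSolution

variable {ω : V → ℍ → ℂ} {F G : ℂ → NCSeries V}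

/-- The derivative of the coefficient at `v :: w` involves only the coefficient at `w`, so
uniqueness of primitives on the connected half plane propagates by induction on the word. -/
theorem eq_of_eq_at (hF : IsSolution ω F) (hG : IsSolution ω G) {z₀ : ℂ} (hz₀ : 0 < z₀.im)
    (h : F z₀ = G z₀) {z : ℂ} (hz : 0 < z.im) : F z = G z := by
  funext w
  induction w generalizing z with
  | nil => rw [hF.nil z hz, hG.nil z hz]
  | cons v w ih =>
    refine eq_of_hasDerivAt_eq (g := fun z => G z (v :: w)) (fun u hu => hF.cons u hu v w)
      (fun u hu => ?_) hz₀
      (congrFun h (v :: w)) hz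
    rw [ih hu]
    exact hG.cons u hu v w

/-- Differentiation strips the first letter, which lies in the left factor in every cut of the word
except the one with empty left piece; that cut contributes only the constant `C (v :: w)`. -/
theorem mul_const (hG : IsSolution ω G) {C : NCSeries V} (hC : C [] = 1) :
    IsSolution ω fun z => G z * C where
  nil z hz := by rw [NCSeries.mul_nil, hG.nil z hz, hC, one_mul]
  cons z hz v w := by
    have h : HasDerivAt (fun z => C (v :: w) +
        ∑ i ∈ Finset.range (w.length + 1), G z (v :: w.take i) * C (w.drop i))
        (0 + ∑ i ∈ Finset.range (w.length + 1),
          ω v (UpperHalfPlane.ofComplex z) * G z (w.take i) * C (w.drop i)) z :=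
      (hasDerivAt_const z (C (v :: w))).add
        (HasDerivAt.fun_sum fun i _ => (hG.cons z hz v (w.take i)).mul_const _)
    refine (h.congr_of_eventuallyEq ?_).congr_deriv ?_
    · filter_upwards [eventually_im_pos hz] with u hu
      rw [NCSeries.mul_cons, hG.nil u hu, one_mul]
      rfl
    · rw [zero_add, NCSeries.mul_apply, Finset.mul_sum]
      exact Finset.sum_congr rfl fun i _ => mul_assoc _ _ _

theorem exists_eq_mul (hF : IsSolution ω F) (hG : IsSolution ω G) :
    ∃ C : NCSeries V, ∀ z, 0 < z.im → F z = G z * C := by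
  have hI : 0 < Complex.I.im := by simp
  -- The constant is G(i)⁻¹F(i), with i an arbitrary base point. Agreement at i needs only that the
  -- inverse is a right inverse.
  refine ⟨NCSeries.rightInv (G Complex.I) * F Complex.I, fun z hz => ?_⟩
  refine hF.eq_of_eq_at (hG.mul_const ?_) hI ?_ hz
  · rw [NCSeries.mul_nil, NCSeries.rightInv_nil, hF.nil _ hI, one_mul]
  · rw [← mul_assoc, NCSeries.mul_rightInv (hG.nil _ hI), one_mul]

theorem comp_mob (hF : IsSolution ω F) (g : SL(2, ℤ)) :
    IsSolution (fun v => formPullback g (ω v)) fun z => F (mob g z) where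
  nil z hz := hF.nil _ (mob_im_pos g hz)
  cons z hz v w := by
    refine ((hF.cons _ (mob_im_pos g hz) v w).comp z (hasDerivAt_mob g hz)).congr_deriv ?_
    rw [ofComplex_mob g hz, formPullback_apply, coe_ofComplex hz]
    ring

/-- Replacing A_u by ∑_w L(u, w) A_w in Ω amounts to transforming the forms by the transposed
matrix. -/
theorem subst [Fintype V] (hF : IsSolution ω F) (L : V → V → ℂ) :
    IsSolution (fun w z => ∑ u, L u w * ω u z) fun z => NCSeries.subst L (F z) where
  nil z hz := by rw [NCSeries.subst_nil, hF.nil z hz]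
  cons z hz v w := by
    simp only [NCSeries.subst_cons, Finset.sum_mul]
    refine HasDerivAt.fun_sum fun u _ => ?_
    simp only [NCSeries.subst, Finset.mul_sum]
    refine HasDerivAt.fun_sum fun f _ => ?_
    refine (((hF.cons z hz u (List.ofFn f)).mul_const
      (∏ i, L (f i) (w.get i))).const_mul (L u v)).congr_deriv ?_
    ring

end IsSolution

/-! ### Limits at cusps -/

/-- The limit of `F` at the cusp `c` along geodesics is `A`. -/
def LimAt (c : OnePoint ℚ) (F : ℂ → NCSeries V) (A : NCSeries V) : Prop :=
  ∀ g : SL(2, ℤ), cuspAct g ∞ = c → ∀ (x : ℝ) (w : List V),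
    Tendsto (fun y : ℝ => F (mob g (x + y * Complex.I)) w) atTop (𝓝 (A w))

theorem mob_add_mul_I_im_pos (g : SL(2, ℤ)) (x : ℝ) {y : ℝ} (hy : 0 < y) :
    0 < (mob g (x + y * Complex.I)).im :=
  mob_im_pos g (by simpa using hy)

theorem LimAt.congr {c : OnePoint ℚ} {F G : ℂ → NCSeries V} {A : NCSeries V}
    (hF : LimAt c F A) (h : ∀ z, 0 < z.im → F z = G z) : LimAt c G A := by
  intro g hg x w
  refine (hF g hg x w).congr' ?_
  filter_upwards [eventually_gt_atTop 0] with y hy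
  rw [h _ (mob_add_mul_I_im_pos g x hy)]

theorem LimAt.mul_const {c : OnePoint ℚ} {F : ℂ → NCSeries V} {A : NCSeries V}
    (hF : LimAt c F A) (C : NCSeries V) : LimAt c (fun z => F z * C) (A * C) :=
  fun g hg x w => NCSeries.tendsto_mul_const (hF g hg x) C w

theorem LimAt.subst [Fintype V] {c : OnePoint ℚ} {F : ℂ → NCSeries V} {A : NCSeries V}
    (hF : LimAt c F A) (L : V → V → ℂ) :
    LimAt c (fun z => NCSeries.subst L (F z)) (NCSeries.subst L A) :=
  fun g hg x w => NCSeries.tendsto_subst (hF g hg x) L w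

/-- `LimAt` quantifies over all matrices taking ∞ to the cusp, so composing with g only replaces h
by gh. -/
theorem LimAt.comp_mob {c : OnePoint ℚ} {F : ℂ → NCSeries V} {A : NCSeries V} {g : SL(2, ℤ)}
    (hF : LimAt (cuspAct g c) F A) : LimAt c (fun z => F (mob g z)) A := by
  intro h hh x w
  refine (hF (g * h) (by rw [cuspAct_mul, hh]) x w).congr' ?_
  filter_upwards [eventually_gt_atTop 0] with y hy
  rw [mob_mul _ _ (by simpa using hy)]

theorem LimAt.unique {c : OnePoint ℚ} {F : ℂ → NCSeries V} {A B : NCSeries V}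
    (hA : LimAt c F A) (hB : LimAt c F B) : A = B := by
  obtain ⟨g, hg⟩ := exists_cuspAct_infty c
  funext w
  exact tendsto_nhds_unique (hA g hg 0 w) (hB g hg 0 w)

/-- Elements of `SL(2, ℤ)` that send `∞` to the same cusp differ by a translation. -/
theorem exists_mob_eq_mob_add {g h : SL(2, ℤ)} (e : cuspAct g ∞ = cuspAct h ∞) :
    ∃ n : ℤ, ∀ z : ℂ, 0 < z.im → mob h z = mob g (z + n) := by
  have h1 : cuspAct (g⁻¹ * h) ∞ = ∞ := by rw [cuspAct_mul, cuspAct_inv_eq_iff, e]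
  have h10 : ((g⁻¹ * h) 1 0 : ℤ) = 0 := by
    rw [cuspAct_infty] at h1
    by_contra hne
    rw [if_neg hne] at h1
    exact OnePoint.coe_ne_infty _ h1
  have hdet : ((g⁻¹ * h) 0 0 : ℤ) * (g⁻¹ * h) 1 1 = 1 := by
    have := (g⁻¹ * h).det_coe
    rw [Matrix.det_fin_two, h10] at this
    linarith
  have key : ∃ n : ℤ, ∀ z : ℂ, mob (g⁻¹ * h) z = z + n := by
    rcases Int.mul_eq_one_iff_eq_one_or_neg_one.mp hdet with ⟨e1, e2⟩ | ⟨e1, e2⟩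
    · exact ⟨(g⁻¹ * h) 0 1, fun z => by simp only [mob, h10, e1, e2]; simp⟩
    · exact ⟨-(g⁻¹ * h) 0 1, fun z => by
        simp only [mob, h10, e1, e2]; push_cast; ring⟩
  obtain ⟨n, hn⟩ := key
  refine ⟨n, fun z hz => ?_⟩
  rw [← hn, ← mob_mul _ _ hz, mul_inv_cancel_left]

/-- One matrix suffices: any other differs from it by an integer translation, which the arbitrary
abscissa absorbs. -/
theorem limAt_of_forall_tendsto {c : OnePoint ℚ} {F : ℂ → NCSeries V} {A : NCSeries V}
    (g : SL(2, ℤ)) (hg : cuspAct g ∞ = c) (h : ∀ (x : ℝ) (w : List V),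
      Tendsto (fun y : ℝ => F (mob g (x + y * Complex.I)) w) atTop (𝓝 (A w))) :
    LimAt c F A := by
  intro g' hg' x w
  obtain ⟨n, hn⟩ := exists_mob_eq_mob_add (hg.trans hg'.symm)
  refine (h (x + n) w).congr' ?_
  filter_upwards [eventually_gt_atTop 0] with y hy
  rw [hn _ (by simpa using hy)]
  push_cast
  ring_nf

/-! ### Primitives of forms that decay at the cusps -/

/-- `φ` is `O(1 / y ^ n)` in vertical strips, as `y = im z` grows. -/
def StripDecay (n : ℕ) (φ : ℂ → ℂ) : Prop :=
  ∀ R : ℝ, ∃ C : ℝ, ∀ z : ℂ, 1 ≤ z.im → |z.re| ≤ R → ‖φ z‖ ≤ C / z.im ^ n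

theorem StripDecay.mul {m n : ℕ} {φ ψ : ℂ → ℂ} (hφ : StripDecay m φ) (hψ : StripDecay n ψ) :
    StripDecay (m + n) fun z => φ z * ψ z := by
  intro R
  obtain ⟨C, hC⟩ := hφ R
  obtain ⟨D, hD⟩ := hψ R
  refine ⟨C * D, fun z h1 h2 => ?_⟩
  rw [norm_mul, pow_add, mul_div_mul_comm]
  exact mul_le_mul (hC z h1 h2) (hD z h1 h2) (norm_nonneg _) ((norm_nonneg _).trans (hC z h1 h2))

theorem StripDecay.mono {m n : ℕ} (h : m ≤ n) {φ : ℂ → ℂ} (hφ : StripDecay n φ) :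
    StripDecay m φ := by
  intro R
  obtain ⟨C, hC⟩ := hφ R
  refine ⟨C, fun z h1 h2 => (hC z h1 h2).trans ?_⟩
  have hC0 : 0 ≤ C := by
    have := (norm_nonneg _).trans (hC z h1 h2)
    by_contra! hneg
    exact absurd this (not_le.mpr (div_neg_of_neg_of_pos hneg (by positivity)))
  exact div_le_div_of_nonneg_left hC0 (by positivity) (pow_le_pow_right₀ h1 h)

theorem StripDecay.tendsto {n : ℕ} {φ : ℂ → ℂ} (hφ : StripDecay (n + 1) φ) (x : ℝ) :
    Tendsto (fun y : ℝ => φ (x + y * Complex.I)) atTop (𝓝 0) := by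
  obtain ⟨C, hC⟩ := hφ.mono (m := 1) (by omega) |x|
  refine squeeze_zero_norm' ?_ ((tendsto_const_nhds (x := C)).div_atTop tendsto_id)
  filter_upwards [eventually_ge_atTop 1] with y hy
  simpa using hC (x + y * Complex.I) (by simpa using hy) (by simp)

/-- A holomorphic function on the upper half plane has a primitive. -/
theorem exists_primitive {φ : ℂ → ℂ} (hφ : DifferentiableOn ℂ φ {z | 0 < z.im}) :
    ∃ Φ : ℂ → ℂ, ∀ z, 0 < z.im → HasDerivAt Φ (φ z) z := by
  have hne : ∀ z : ℂ, 0 < z.im → z + Complex.I ≠ 0 := fun z hz h => by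
    have := congrArg Complex.im h
    simp at this
    linarith
  -- κ is the inverse Cayley transform from the unit disc to the half plane. The form φ dz is pulled
  -- back to the disc, where primitives exist, and the primitive is carried back.
  set κ : ℂ → ℂ := fun w => Complex.I * (1 + w) / (1 - w) with hκ
  have hw1 : ∀ w ∈ Metric.ball (0 : ℂ) 1, 1 - w ≠ 0 := fun w hw h => by
    rw [← sub_eq_zero.mp h] at hw
    simp at hw
  have hκim : ∀ w ∈ Metric.ball (0 : ℂ) 1, 0 < (κ w).im := fun w hw => by
    have h1 := hw1 w hw
    have h2 : Complex.normSq w < 1 := by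
      rw [Complex.normSq_eq_norm_sq]
      have : ‖w‖ < 1 := by simpa using hw
      nlinarith [norm_nonneg w]
    have h3 : 0 < Complex.normSq (1 - w) := Complex.normSq_pos.mpr h1
    have : (κ w).im = (1 - Complex.normSq w) / Complex.normSq (1 - w) := by
      rw [hκ]
      simp only [Complex.div_im, Complex.mul_im, Complex.mul_re, Complex.I_re, Complex.I_im,
        Complex.add_re, Complex.add_im, Complex.sub_re, Complex.sub_im, Complex.one_re,
        Complex.one_im]
      field_simp
      rw [Complex.normSq_apply w]
      ring
    rw [this]
    exact div_pos (by linarith) h3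
  have hκd : ∀ w ∈ Metric.ball (0 : ℂ) 1,
      HasDerivAt κ (2 * Complex.I / (1 - w) ^ 2) w := fun w hw => by
    have h1 := hw1 w hw
    refine ((((hasDerivAt_id w).const_add 1).const_mul Complex.I).div
      ((hasDerivAt_id w).const_sub 1) h1).congr_deriv ?_
    simp only [id]
    congr 1
    ring
  have hG : DifferentiableOn ℂ (fun w => φ (κ w) * (2 * Complex.I / (1 - w) ^ 2))
      (Metric.ball 0 1) := by
    refine DifferentiableOn.mul (hφ.comp (fun w hw =>
      (hκd w hw).differentiableAt.differentiableWithinAt) hκim) ?_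
    exact DifferentiableOn.div (by fun_prop) (by fun_prop) fun w hw => pow_ne_zero _ (hw1 w hw)
  obtain ⟨G, hG⟩ := hG.isExactOn_ball
  refine ⟨fun z => G ((z - Complex.I) / (z + Complex.I)), fun z hz => ?_⟩
  have hz0 := hne z hz
  have hmem : (z - Complex.I) / (z + Complex.I) ∈ Metric.ball (0 : ℂ) 1 := by
    rw [mem_ball_zero_iff, norm_div, div_lt_one (norm_pos_iff.mpr hz0), ← sq_lt_sq₀
      (norm_nonneg _) (norm_nonneg _), ← Complex.normSq_eq_norm_sq, ← Complex.normSq_eq_norm_sq,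
      Complex.normSq_apply, Complex.normSq_apply]
    simp
    nlinarith
  have hd : HasDerivAt (fun z => (z - Complex.I) / (z + Complex.I))
      (2 * Complex.I / (z + Complex.I) ^ 2) z := by
    refine (((hasDerivAt_id z).sub_const Complex.I).div
      ((hasDerivAt_id z).add_const Complex.I) hz0).congr_deriv ?_
    simp only [id]
    congr 1
    ring
  refine ((hG _ hmem).comp z hd).congr_deriv ?_
  have e1 : 1 - (z - Complex.I) / (z + Complex.I) = 2 * Complex.I / (z + Complex.I) := by
    field_simp
    ring
  have e2 : κ ((z - Complex.I) / (z + Complex.I)) = z := by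
    rw [hκ]
    simp only [e1]
    have : 1 + (z - Complex.I) / (z + Complex.I) = 2 * z / (z + Complex.I) := by
      field_simp
      ring
    rw [this]
    field_simp
  simp only [e2, e1]
  field_simp

/-- Decay 1/y² is integrable up the imaginary axis, so any primitive has a limit there. Subtracting
it leaves an error O(1/y) on the axis, and moving sideways within the strip costs only O(1/y²). -/
theorem exists_primitive_stripDecay {φ : ℂ → ℂ} (hφ : DifferentiableOn ℂ φ {z | 0 < z.im})
    (hd : StripDecay 2 φ) :
    ∃ Φ : ℂ → ℂ, (∀ z, 0 < z.im → HasDerivAt Φ (φ z) z) ∧ StripDecay 1 Φ := by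
  obtain ⟨Φ, hΦ⟩ := exists_primitive hφ
  have vert : ∀ x : ℝ, ∀ y : ℝ, 0 < y →
      HasDerivAt (fun y : ℝ => Φ (x + y * Complex.I)) (φ (x + y * Complex.I) * Complex.I) y := by
    intro x y hy
    have h1 : HasDerivAt (fun y : ℝ => (x + y * Complex.I : ℂ)) Complex.I y := by
      simpa using ((Complex.ofRealCLM.hasDerivAt (x := y)).mul_const Complex.I).const_add (x : ℂ)
    exact (hΦ (x + y * Complex.I) (by simpa using hy)).comp y h1
  have vbound : ∀ R : ℝ, ∃ C : ℝ, 0 ≤ C ∧ ∀ z : ℂ, 1 ≤ z.im → |z.re| ≤ R →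
      ‖φ z‖ ≤ C / z.im ^ 2 := by
    intro R
    obtain ⟨C, hC⟩ := hd R
    refine ⟨max C 0, le_max_right _ _, fun z h1 h2 => (hC z h1 h2).trans ?_⟩
    exact div_le_div_of_nonneg_right (le_max_left _ _) (by positivity)
  have hosc : ∀ C : ℝ, 0 ≤ C → (∀ z : ℂ, 1 ≤ z.im → |z.re| ≤ 0 → ‖φ z‖ ≤ C / z.im ^ 2) →
      ∀ y₁ y₂ : ℝ, 1 ≤ y₁ → y₁ ≤ y₂ →
        ‖Φ ((0 : ℝ) + y₂ * Complex.I) - Φ ((0 : ℝ) + y₁ * Complex.I)‖ ≤ C / y₁ := by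
    intro C hC0 hC y₁ y₂ h1 h12
    -- The comparison function C/y₁ - C/y is the integral of C/y² from y₁ to y.
    have hB : ∀ y : ℝ, 1 ≤ y → HasDerivAt (fun y : ℝ => C / y₁ - C / y) (C / y ^ 2) y := by
      intro y hy
      have : y ≠ 0 := by positivity
      refine (((hasDerivAt_const y C).div (hasDerivAt_id y) this).const_sub (C / y₁)).congr_deriv ?_
      simp only [id]
      ring
    have key := image_norm_le_of_norm_deriv_right_le_deriv_boundary' (a := y₁) (b := y₂)
      (f := fun y : ℝ => Φ ((0 : ℝ) + y * Complex.I) - Φ ((0 : ℝ) + y₁ * Complex.I))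
      (f' := fun y => φ ((0 : ℝ) + y * Complex.I) * Complex.I)
      (B := fun y => C / y₁ - C / y) (B' := fun y => C / y ^ 2)
      (fun y hy => ((vert 0 y (by linarith [hy.1])).sub_const _).continuousAt.continuousWithinAt)
      (fun y hy => ((vert 0 y (by linarith [hy.1])).sub_const _).hasDerivWithinAt)
      (by simp)
      (fun y hy => (hB y (by linarith [hy.1])).continuousAt.continuousWithinAt)
      (fun y hy => (hB y (by linarith [hy.1])).hasDerivWithinAt)
      (fun y hy => by
        rw [norm_mul, Complex.norm_I, mul_one]
        simpa using hC ((0 : ℝ) + y * Complex.I) (by simpa using h1.trans hy.1) (by simp))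
      (Set.right_mem_Icc.mpr h12)
    refine key.trans (sub_le_self _ (div_nonneg hC0 (by linarith)))
  obtain ⟨C₀, hC₀, hb₀⟩ := vbound 0
  have hosc₀ := hosc C₀ hC₀ hb₀
  obtain ⟨L, hL⟩ : ∃ L, Tendsto (fun y : ℝ => Φ ((0 : ℝ) + y * Complex.I)) atTop (𝓝 L) := by
    refine cauchySeq_tendsto_of_complete ?_
    refine Metric.cauchySeq_iff'.mpr fun ε hε => ⟨C₀ / ε + 1, fun y hy => ?_⟩
    have hN : 1 ≤ C₀ / ε + 1 := le_add_of_nonneg_left (div_nonneg hC₀ hε.le)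
    rw [dist_eq_norm]
    refine (hosc₀ _ y hN hy).trans_lt ?_
    rw [div_lt_iff₀ (by linarith), mul_add, mul_div_cancel₀ _ hε.ne']
    linarith
  have hvert : ∀ y : ℝ, 1 ≤ y → ‖Φ ((0 : ℝ) + y * Complex.I) - L‖ ≤ C₀ / y := by
    intro y hy
    rw [norm_sub_rev]
    refine le_of_tendsto (hL.sub_const _).norm ?_
    filter_upwards [eventually_ge_atTop y] with u hu using hosc₀ y u hy hu
  refine ⟨fun z => Φ z - L, fun z hz => (hΦ z hz).sub_const L, fun R => ?_⟩
  obtain ⟨C, hC, hb⟩ := vbound R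
  refine ⟨C * R + C₀, fun z h1 h2 => ?_⟩
  have hy0 : 0 < z.im := by linarith
  have hR : 0 ≤ R := (abs_nonneg _).trans h2
  -- Mean value inequality along the horizontal segment from the imaginary axis to z.
  have hor : ‖Φ (z.re + z.im * Complex.I) - Φ ((0 : ℝ) + z.im * Complex.I)‖ ≤
      C / z.im ^ 2 * ‖z.re - 0‖ := by
    refine Convex.norm_image_sub_le_of_norm_hasDerivWithin_le (𝕜 := ℝ) (s := Set.Icc (-R) R)
      (f := fun x : ℝ => Φ (x + z.im * Complex.I)) (f' := fun x => φ (x + z.im * Complex.I))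
      (fun x hx => ?_) (fun x hx => ?_) (convex_Icc _ _) ⟨by linarith, hR⟩ (abs_le.mp h2)
    · have h3 : HasDerivAt (fun x : ℝ => (x + z.im * Complex.I : ℂ)) 1 x := by
        simpa using (Complex.ofRealCLM.hasDerivAt (x := x)).add_const (z.im * Complex.I)
      have := (hΦ (x + z.im * Complex.I) (by simpa using hy0)).comp x h3
      rw [mul_one] at this
      exact this.hasDerivWithinAt
    · simpa using hb (x + z.im * Complex.I) (by simpa using h1) (by simpa using abs_le.mpr hx)
  rw [sub_zero, Real.norm_eq_abs, Complex.re_add_im] at hor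
  calc ‖Φ z - L‖ = ‖(Φ z - Φ ((0 : ℝ) + z.im * Complex.I)) +
        (Φ ((0 : ℝ) + z.im * Complex.I) - L)‖ := by ring_nf
    _ ≤ C / z.im ^ 2 * |z.re| + C₀ / z.im := (norm_add_le _ _).trans (add_le_add hor (hvert _ h1))
    _ ≤ C / z.im * R + C₀ / z.im := by
      gcongr
      exact le_self_pow₀ h1 two_ne_zero
    _ = (C * R + C₀) / z.im ^ 1 := by rw [pow_one]; ring

/-! ### One-forms that decay at all cusps -/

/-- The form `h(z) dz` is holomorphic, and so small at all cusps that its integrals along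
geodesics between cusps converge. -/
structure IsCuspidal (h : ℍ → ℂ) : Prop where
  holo : DifferentiableOn ℂ (fun z => h (UpperHalfPlane.ofComplex z)) {z | 0 < z.im}
  decay : ∀ g : SL(2, ℤ), StripDecay 2 fun z => formPullback g h (UpperHalfPlane.ofComplex z)

theorem differentiableOn_formPullback {h : ℍ → ℂ}
    (hh : DifferentiableOn ℂ (fun z => h (UpperHalfPlane.ofComplex z)) {z | 0 < z.im})
    (g : SL(2, ℤ)) : DifferentiableOn ℂ
      (fun z => formPullback g h (UpperHalfPlane.ofComplex z)) {z | 0 < z.im} := by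
  have : DifferentiableOn ℂ (fun z => h (UpperHalfPlane.ofComplex (mob g z)) *
      (((g 1 0 : ℤ) : ℂ) * z + ((g 1 1 : ℤ) : ℂ)) ^ (-2 : ℤ)) {z | 0 < z.im} := by
    refine (hh.comp (fun z hz =>
      (hasDerivAt_mob g hz).differentiableAt.differentiableWithinAt)
      fun z hz => mob_im_pos g hz).mul ?_
    exact DifferentiableOn.zpow (by fun_prop) (Or.inl fun z hz => denom_ne_zero g hz)
  refine this.congr fun z hz => ?_
  rw [formPullback_apply, ofComplex_mob g hz, coe_ofComplex hz]

theorem IsCuspidal.formPullback {h : ℍ → ℂ} (hh : IsCuspidal h) (g : SL(2, ℤ)) :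
    IsCuspidal (formPullback g h) where
  holo := differentiableOn_formPullback hh.holo g
  decay g' := by
    simpa only [← formPullback_mul] using hh.decay (g * g')

/-- Iterated primitives, all of which vanish at `∞`. -/
theorem exists_isSolution_infty {ω : V → ℍ → ℂ} (hω : ∀ v, IsCuspidal (ω v)) :
    ∃ F, IsSolution ω F ∧ ∀ (x : ℝ) (w : List V),
      Tendsto (fun y : ℝ => F (x + y * Complex.I) w) atTop (𝓝 ((1 : NCSeries V) w)) := by
  -- Primitives are chosen for every φ, with junk value 0 for bad ones, so that the recursion on
  -- words can be defined before its terms are known to be holomorphic and decaying.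
  have H : ∀ φ : ℂ → ℂ, ∃ Φ : ℂ → ℂ, DifferentiableOn ℂ φ {z | 0 < z.im} → StripDecay 2 φ →
      (∀ z, 0 < z.im → HasDerivAt Φ (φ z) z) ∧ StripDecay 1 Φ := by
    intro φ
    by_cases h : DifferentiableOn ℂ φ {z | 0 < z.im} ∧ StripDecay 2 φ
    · obtain ⟨Φ, hΦ⟩ := exists_primitive_stripDecay h.1 h.2
      exact ⟨Φ, fun _ _ => hΦ⟩
    · exact ⟨0, fun h1 h2 => absurd ⟨h1, h2⟩ h⟩
  choose prim hprim using H
  let F : List V → ℂ → ℂ := fun w => w.rec (fun _ => 1)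
    fun v _ f => prim fun z => ω v (UpperHalfPlane.ofComplex z) * f z
  have hF0 : F [] = fun _ => 1 := rfl
  have hF : ∀ v w, F (v :: w) = prim fun z => ω v (UpperHalfPlane.ofComplex z) * F w z :=
    fun v w => rfl
  have hωd : ∀ v, StripDecay 2 fun z => ω v (UpperHalfPlane.ofComplex z) := fun v => by
    simpa only [formPullback_one] using (hω v).decay 1
  -- Boundedness is the right invariant: it holds for the constant 1, and a bounded factor keeps the
  -- decay 1/y² whose primitive is O(1/y).
  have hnice : ∀ w, DifferentiableOn ℂ (F w) {z | 0 < z.im} ∧ StripDecay 0 (F w) := by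
    intro w
    induction w with
    | nil => exact ⟨by rw [hF0]; fun_prop, fun R => ⟨1, fun z _ _ => by simp [hF0]⟩⟩
    | cons v w ih =>
      have := hprim (fun z => ω v (UpperHalfPlane.ofComplex z) * F w z)
        ((hω v).holo.mul ih.1) ((hωd v).mul ih.2)
      rw [← hF] at this
      exact ⟨fun z hz => (this.1 z hz).differentiableAt.differentiableWithinAt,
        this.2.mono zero_le_one⟩
  have hprim' := fun v w => hprim (fun z => ω v (UpperHalfPlane.ofComplex z) * F w z)
        ((hω v).holo.mul (hnice w).1) ((hωd v).mul (hnice w).2)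
  refine ⟨fun z w => F w z, ⟨fun z _ => rfl, fun z hz v w => (hprim' v w).1 z hz⟩, fun x w => ?_⟩
  cases w with
  | nil => exact tendsto_const_nhds
  | cons v w => exact (hprim' v w).2.tendsto x

/-- The cusp is moved to ∞ by g: solve there for the forms pulled back by g, then compose with g⁻¹.
-/
theorem exists_isSolution_limAt {ω : V → ℍ → ℂ} (hω : ∀ v, IsCuspidal (ω v)) (c : OnePoint ℚ) :
    ∃ F, IsSolution ω F ∧ LimAt c F 1 := by
  obtain ⟨g, hg⟩ := exists_cuspAct_infty c
  obtain ⟨F, hF, hlim⟩ := exists_isSolution_infty fun v => (hω v).formPullback g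
  have h := hF.comp_mob g⁻¹
  simp only [← formPullback_mul, mul_inv_cancel, formPullback_one] at h
  refine ⟨_, h, limAt_of_forall_tendsto g hg fun x w => (hlim x w).congr' ?_⟩
  filter_upwards [eventually_gt_atTop 0] with y hy
  rw [← mob_mul _ _ (by simpa using hy), inv_mul_cancel, mob_one]

/-! ### Geodesics between cusps -/

/-- This lets every statement at the initial cusp be deduced from the one at the final cusp. -/
theorem geodesic_symm (a b : OnePoint ℚ) (t : ℝ) : geodesic a b t = geodesic b a (-t) := by
  cases a with
  | infty =>
    cases b with
    | infty => rfl
    | coe y => rfl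
  | coe x =>
    cases b with
    | infty => change _ = (x : ℂ) + Real.exp (- -t) * Complex.I; rw [neg_neg]; rfl
    | coe y =>
      change ((x : ℂ) + y) / 2 + ((y : ℂ) - x) / 2 * Real.tanh t +
          |(y : ℝ) - x| / (2 * Real.cosh t) * Complex.I =
        ((y : ℂ) + x) / 2 + ((x : ℂ) - y) / 2 * Real.tanh (-t) +
          |(x : ℝ) - y| / (2 * Real.cosh (-t)) * Complex.I
      rw [Real.tanh_neg, Real.cosh_neg, abs_sub_comm]
      push_cast
      ring

theorem deriv_geodesic_self (a : OnePoint ℚ) (t : ℝ) : deriv (geodesic a a) t = 0 := by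
  cases a with
  | infty => exact deriv_const t (0 : ℂ)
  | coe x =>
    have : geodesic (x : OnePoint ℚ) (x : OnePoint ℚ) = fun _ => (x : ℂ) := by
      funext t
      change ((x : ℂ) + x) / 2 + ((x : ℂ) - x) / 2 * Real.tanh t +
          |(x : ℝ) - x| / (2 * Real.cosh t) * Complex.I = x
      simp
    rw [this]
    exact deriv_const t _

/-- The half-circle from `x` to `y` as the image of the positive imaginary half-line. -/
theorem geodesic_coe_coe {x y : ℚ} (h : x ≠ y) (t : ℝ) :
    ∃ s : ℂ, s ^ 2 = 1 ∧ s * ((y : ℂ) - x) = |(y : ℝ) - x| ∧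
      Real.exp t * Complex.I + s ≠ 0 ∧
      geodesic x y t = (y * (Real.exp t * Complex.I) + s * x) / (Real.exp t * Complex.I + s) := by
  -- Here s is the sign of y - x. The map w ↦ (yw + sx)/(w + s) sends 0 to x and ∞ to y, and its
  -- determinant s(y - x) = |y - x| is positive, so it preserves the half plane.
  have key : ∀ s : ℝ, s ^ 2 = 1 → s * ((y : ℝ) - x) = |(y : ℝ) - x| →
      (Real.exp t * Complex.I + s : ℂ) ≠ 0 ∧
      geodesic x y t = (y * (Real.exp t * Complex.I) + s * x) / (Real.exp t * Complex.I + s) := by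
    intro s hs1 hs2
    have hE : 0 < Real.exp t := Real.exp_pos t
    have hne : (Real.exp t * Complex.I + s : ℂ) ≠ 0 := fun h0 => by
      have := congrArg Complex.im h0
      simp only [Complex.add_im, Complex.im_ofReal_mul, Complex.I_im, Complex.ofReal_im,
        mul_one, add_zero, Complex.zero_im] at this
      exact hE.ne' this
    refine ⟨hne, ?_⟩
    rw [eq_div_iff hne]
    change (((x : ℂ) + y) / 2 + ((y : ℂ) - x) / 2 * Real.tanh t +
          |(y : ℝ) - x| / (2 * Real.cosh t) * Complex.I) * _ = _
    rw [← hs2, Real.tanh_eq_sinh_div_cosh, Real.sinh_eq, Real.cosh_eq, Real.exp_neg]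
    set E := Real.exp t
    have hE0 : (E : ℂ) ≠ 0 := by exact_mod_cast hE.ne'
    have hE1 : (E ^ 2 + 1 : ℂ) ≠ 0 := by
      have : (0 : ℝ) < E ^ 2 + 1 := by positivity
      exact_mod_cast this.ne'
    have hs1' : (s : ℂ) ^ 2 = 1 := by exact_mod_cast hs1
    have hI := Complex.I_sq
    push_cast
    field_simp
    linear_combination (2 * ((y : ℂ) - x) * E ^ 2 * s) * hI +
      (2 * ((y : ℂ) - x) * E * Complex.I) * hs1'
  rcases lt_or_gt_of_ne h with h1 | h1
  · have h2 : (x : ℝ) < y := by exact_mod_cast h1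
    obtain ⟨e1, e2⟩ := key 1 (by norm_num) (by rw [one_mul, abs_of_pos (by linarith)])
    rw [abs_of_pos (by linarith)]
    exact ⟨1, by norm_num, by simp, by simpa using e1, by simpa using e2⟩
  · have h2 : (y : ℝ) < x := by exact_mod_cast h1
    obtain ⟨e1, e2⟩ := key (-1) (by norm_num) (by rw [abs_of_neg (by linarith)]; ring)
    rw [abs_of_neg (by linarith)]
    exact ⟨-1, by norm_num, by simp, by simpa using e1, by simpa using e2⟩

/-- A geodesic that ends at the cusp `g(∞)` is the image under `g` of a vertical half-line. -/
theorem exists_geodesic_eq_mob {a b : OnePoint ℚ} (hab : a ≠ b) (g : SL(2, ℤ))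
    (hg : cuspAct g ∞ = b) : ∃ x r : ℝ, 0 < r ∧
      ∀ t : ℝ, geodesic a b t = mob g (x + (r * Real.exp t : ℝ) * Complex.I) := by
  have hdet : ((g 0 0 : ℤ) : ℂ) * ((g 1 1 : ℤ) : ℂ) - ((g 0 1 : ℤ) : ℂ) * ((g 1 0 : ℤ) : ℂ) = 1 := by
    have := g.det_coe
    rw [Matrix.det_fin_two] at this
    exact_mod_cast this
  rw [cuspAct_infty] at hg
  split_ifs at hg with hq
  · subst hg
    have hdetZ : (g 0 0 : ℤ) * (g 1 1 : ℤ) = 1 := by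
      have := g.det_coe
      rw [Matrix.det_fin_two, hq] at this
      linarith
    have hsq : ∃ e : ℤ, (e = 1 ∨ e = -1) ∧ (g 0 0 : ℤ) = e ∧ (g 1 1 : ℤ) = e := by
      rcases Int.mul_eq_one_iff_eq_one_or_neg_one.mp hdetZ with ⟨e1, e2⟩ | ⟨e1, e2⟩
      · exact ⟨1, Or.inl rfl, e1, e2⟩
      · exact ⟨-1, Or.inr rfl, e1, e2⟩
    obtain ⟨e, he, e1, e2⟩ := hsq
    cases a with
    | infty => exact absurd rfl hab
    | coe x =>
      refine ⟨x - e * (g 0 1 : ℤ), 1, one_pos, fun t => ?_⟩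
      change (x : ℂ) + Real.exp t * Complex.I = _
      simp only [mob, hq, e1, e2]
      rcases he with rfl | rfl
      · push_cast; ring
      · push_cast; ring
  · subst hg
    set p := (g 0 0 : ℤ)
    set q := (g 1 0 : ℤ)
    set u := (g 0 1 : ℤ)
    set v := (g 1 1 : ℤ)
    have hqC : (q : ℂ) ≠ 0 := by exact_mod_cast hq
    have hqR : (q : ℝ) ≠ 0 := by exact_mod_cast hq
    -- Partial fractions give gz = p/q - 1/(q(qz + v)); the coordinate w = q(qz + v) makes this p/q
    -- - 1/w.
    have hmob : ∀ w : ℂ, w ≠ 0 → mob g (-v / q + w / q ^ 2) = p / q - 1 / w := by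
      intro w hw
      change ((p : ℂ) * (-v / q + w / q ^ 2) + u) / (q * (-v / q + w / q ^ 2) + v) = _
      have e1 : (q : ℂ) * (-v / q + w / q ^ 2) + v = w / q := by field_simp; ring
      have e2 : (p : ℂ) * (-v / q + w / q ^ 2) + u = p * w / q ^ 2 - 1 / q := by
        have hu : (u : ℂ) = (p * v - 1) / q := by
          field_simp
          linear_combination -hdet
        rw [hu]
        field_simp
        ring
      rw [e1, e2]
      field_simp
    cases a with
    | infty =>
      -- Taking w = ie^t gives p/q + ie^{-t}, the vertical half-line descending from ∞.
      refine ⟨-v / q, 1 / q ^ 2, by positivity, fun t => ?_⟩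
      have hw : (Real.exp t * Complex.I : ℂ) ≠ 0 := by simp
      have := hmob _ hw
      change (((p : ℚ) / (q : ℚ) : ℚ) : ℂ) + Real.exp (-t) * Complex.I = _
      have e3 : (((-v / q : ℝ) : ℂ) + ((1 / q ^ 2 * Real.exp t : ℝ) : ℂ) * Complex.I : ℂ) =
          -v / q + (Real.exp t * Complex.I) / q ^ 2 := by push_cast; ring
      rw [e3, this, Real.exp_neg]
      have hE : (Real.exp t : ℂ) ≠ 0 := by exact_mod_cast (Real.exp_pos t).ne'
      push_cast
      rw [one_div (_ * _), mul_inv, Complex.inv_I]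
      ring
    | coe x =>
      have hxy : x ≠ (p : ℚ) / q := fun h => hab (by rw [h])
      have hyR : ((p : ℝ) / q) - x ≠ 0 := fun h => hxy (by
        have : (x : ℝ) = ((p / q : ℚ) : ℝ) := by push_cast; linarith
        exact_mod_cast this)
      -- The vertical line stands over g⁻¹(x), where w = 1/(p/q - x); the imaginary part of w is
      -- e^t/|p/q - x|.
      refine ⟨-v / q + 1 / (q ^ 2 * (p / q - x)), 1 / (q ^ 2 * |(p : ℝ) / q - x|), by positivity,
        fun t => ?_⟩
      obtain ⟨s, hs1, hs2, hne, hgeo⟩ := geodesic_coe_coe hxy t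
      have hs0 : s ≠ 0 := by rintro rfl; norm_num at hs1
      have hyC : (((p : ℚ) / q : ℚ) : ℂ) - x ≠ 0 := by
        intro h
        apply hyR
        have : (((p : ℝ) / q - x : ℝ) : ℂ) = 0 := by push_cast; push_cast at h; exact h
        exact_mod_cast this
      have e3 : (((-v / q + 1 / (q ^ 2 * (p / q - x)) : ℝ) : ℂ) +
          ((1 / (q ^ 2 * |(p : ℝ) / q - x|) * Real.exp t : ℝ) : ℂ) * Complex.I : ℂ) =
          -v / q + ((Real.exp t * Complex.I + s) / (s * ((((p : ℚ) / q : ℚ) : ℂ) - x))) / q ^ 2 := by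
        have e4 : ((|(p : ℝ) / q - x| : ℝ) : ℂ) = s * ((((p : ℚ) / q : ℚ) : ℂ) - x) := by
          rw [hs2]; push_cast; rfl
        push_cast [e4]
        push_cast at hyC
        generalize (p : ℂ) / q - x = D at *
        field_simp
        ring
      rw [e3, hmob _ (div_ne_zero hne (mul_ne_zero hs0 hyC)), hgeo]
      push_cast at hyC ⊢
      generalize (p : ℂ) / q = Y at *
      push_cast at hne
      field_simp
      ring

/-! ### Iterated integrals along geodesics -/

/-- Seen through g the path is x + iy with y = re^t and dy/dt = y, so decay 1/y² of the pulled-back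
form becomes decay e^{-t} of the integrand. -/
theorem alongPath_geodesic {a b : OnePoint ℚ} (hab : a ≠ b) (g : SL(2, ℤ))
    (hg : cuspAct g ∞ = b) : ∃ x r : ℝ, 0 < r ∧ ∀ t : ℝ,
      HasDerivAt (geodesic a b) (deriv (geodesic a b) t) t ∧
      ∀ h : ℍ → ℂ, alongPath (geodesic a b) h t =
        formPullback g h (UpperHalfPlane.ofComplex (x + (r * Real.exp t : ℝ) * Complex.I)) *
          ((r * Real.exp t : ℝ) * Complex.I) := by
  obtain ⟨x, r, hr, hgeo⟩ := exists_geodesic_eq_mob hab g hg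
  refine ⟨x, r, hr, fun t => ?_⟩
  have hpos : 0 < (x + (r * Real.exp t : ℝ) * Complex.I : ℂ).im := by
    rw [Complex.add_im, Complex.ofReal_im, Complex.im_ofReal_mul, Complex.I_im]
    have := Real.exp_pos t
    simp only [zero_add, mul_one]
    positivity
  have h1 : HasDerivAt (fun t : ℝ => (x + (r * Real.exp t : ℝ) * Complex.I : ℂ))
      ((r * Real.exp t : ℝ) * Complex.I) t :=
    ((((Real.hasDerivAt_exp t).const_mul r).ofReal_comp).mul_const Complex.I).const_add (x : ℂ)
  have h2 := (hasDerivAt_mob g hpos).comp t h1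
  have h3 : geodesic a b = mob g ∘ fun t : ℝ => (x + (r * Real.exp t : ℝ) * Complex.I : ℂ) :=
    funext hgeo
  rw [← h3] at h2
  refine ⟨h2.differentiableAt.hasDerivAt, fun h => ?_⟩
  rw [alongPath, h2.deriv, hgeo, ofComplex_mob g hpos, formPullback_apply, coe_ofComplex hpos,
    mul_assoc]

theorem hasDerivAt_geodesic {a b : OnePoint ℚ} (hab : a ≠ b) (t : ℝ) :
    HasDerivAt (geodesic a b) (deriv (geodesic a b) t) t := by
  obtain ⟨g, hg⟩ := exists_cuspAct_infty b
  obtain ⟨x, r, -, h⟩ := alongPath_geodesic hab g hg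
  exact (h t).1

theorem continuous_alongPath_geodesic {a b : OnePoint ℚ} (hab : a ≠ b) {h : ℍ → ℂ}
    (hh : IsCuspidal h) : Continuous (alongPath (geodesic a b) h) := by
  obtain ⟨g, hg⟩ := exists_cuspAct_infty b
  obtain ⟨x, r, hr, H⟩ := alongPath_geodesic hab g hg
  rw [show alongPath (geodesic a b) h = _ from funext fun t => (H t).2 h]
  refine Continuous.mul ?_ (by fun_prop)
  refine (hh.formPullback g).holo.continuousOn.comp_continuous (by fun_prop) fun t => ?_
  have := Real.exp_pos t
  rw [Set.mem_ofPred_eq, Complex.add_im, Complex.ofReal_im, Complex.im_ofReal_mul, Complex.I_im]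
  simp only [zero_add, mul_one]
  positivity

theorem alongPath_geodesic_isBigO_atTop {a b : OnePoint ℚ} (hab : a ≠ b) {h : ℍ → ℂ}
    (hh : IsCuspidal h) :
    alongPath (geodesic a b) h =O[atTop] fun t => Real.exp (-1 * t) := by
  obtain ⟨g, hg⟩ := exists_cuspAct_infty b
  obtain ⟨x, r, hr, H⟩ := alongPath_geodesic hab g hg
  obtain ⟨C, hC⟩ := hh.decay g |x|
  refine Asymptotics.IsBigO.of_bound (C / r) ?_
  have hlim : Tendsto (fun t => r * Real.exp t) atTop atTop :=
    Real.tendsto_exp_atTop.const_mul_atTop hr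
  filter_upwards [hlim.eventually_ge_atTop 1] with t ht
  have hb := hC (x + (r * Real.exp t : ℝ) * Complex.I)
    (by rw [Complex.add_im, Complex.ofReal_im, Complex.im_ofReal_mul, Complex.I_im]; simpa using ht)
    (by rw [Complex.add_re, Complex.ofReal_re, Complex.re_ofReal_mul, Complex.I_re]; simp)
  rw [Complex.add_im, Complex.ofReal_im, Complex.im_ofReal_mul, Complex.I_im, zero_add,
    mul_one] at hb
  have hE := Real.exp_pos t
  have hrE : 0 < r * Real.exp t := by positivity
  rw [(H t).2, norm_mul, norm_mul, Complex.norm_I, mul_one, Complex.norm_real, Real.norm_eq_abs,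
    abs_of_pos hrE, Real.norm_eq_abs, Real.abs_exp, neg_one_mul, Real.exp_neg]
  calc _ ≤ C / (r * Real.exp t) ^ 2 * (r * Real.exp t) := by gcongr
    _ = C / r * (Real.exp t)⁻¹ := by field_simp

theorem alongPath_geodesic_symm {a b : OnePoint ℚ} (h : ℍ → ℂ) (t : ℝ) :
    alongPath (geodesic a b) h t = -alongPath (geodesic b a) h (-t) := by
  have : geodesic a b = fun t => geodesic b a (-t) := funext (geodesic_symm a b)
  rw [alongPath, alongPath, this, deriv_comp_neg]
  simp

theorem alongPath_geodesic_isBigO_atBot {a b : OnePoint ℚ} (hab : a ≠ b) {h : ℍ → ℂ}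
    (hh : IsCuspidal h) :
    alongPath (geodesic a b) h =O[atBot] fun t => Real.exp (1 * t) := by
  have := ((alongPath_geodesic_isBigO_atTop hab.symm hh).comp_tendsto
    tendsto_neg_atBot_atTop).neg_left
  refine this.congr (fun t => (alongPath_geodesic_symm h t).symm) fun t => ?_
  simp

theorem LimAt.tendsto_geodesic {a b : OnePoint ℚ} (hab : a ≠ b) {F : ℂ → NCSeries V}
    {A : NCSeries V} (hF : LimAt b F A) (w : List V) :
    Tendsto (fun t => F (geodesic a b t) w) atTop (𝓝 (A w)) := by
  obtain ⟨g, hg⟩ := exists_cuspAct_infty b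
  obtain ⟨x, r, hr, hgeo⟩ := exists_geodesic_eq_mob hab g hg
  have hlim : Tendsto (fun t => r * Real.exp t) atTop atTop :=
    Real.tendsto_exp_atTop.const_mul_atTop hr
  simpa only [hgeo, Function.comp_def] using (hF g hg x w).comp hlim

theorem LimAt.tendsto_geodesic_atBot {a b : OnePoint ℚ} (hab : a ≠ b) {F : ℂ → NCSeries V}
    {A : NCSeries V} (hF : LimAt a F A) (w : List V) :
    Tendsto (fun t => F (geodesic a b t) w) atBot (𝓝 (A w)) := by
  simpa only [geodesic_symm a b, Function.comp_def] using
    (hF.tendsto_geodesic hab.symm w).comp tendsto_neg_atBot_atTop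

section

variable {ω : V → ℍ → ℂ} {F : ℂ → NCSeries V} {a b : OnePoint ℚ} {A B : NCSeries V}

theorem IsSolution.hasDerivAt_geodesic (hF : IsSolution ω F) (hab : a ≠ b) (v : V) (w : List V)
    (t : ℝ) : HasDerivAt (fun t => F (geodesic a b t) (v :: w))
      (alongPath (geodesic a b) (ω v) t * F (geodesic a b t) w) t := by
  refine ((hF.cons _ (geodesic_im_pos hab t) v w).comp t
    (ManinShimura.hasDerivAt_geodesic hab t)).congr_deriv ?_
  rw [alongPath]
  ring

theorem IsSolution.continuous_geodesic (hF : IsSolution ω F) (hab : a ≠ b) (w : List V) :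
    Continuous fun t => F (geodesic a b t) w := by
  cases w with
  | nil =>
    simp only [hF.nil _ (geodesic_im_pos hab _)]
    exact continuous_const
  | cons v w =>
    exact continuous_iff_continuousAt.mpr fun t => (hF.hasDerivAt_geodesic hab v w t).continuousAt

/-- The limits of F at both cusps keep it bounded at both ends, where the form itself decays
exponentially. -/
theorem IsSolution.integrable (hω : ∀ v, IsCuspidal (ω v)) (hF : IsSolution ω F) (hab : a ≠ b)
    (hA : LimAt a F A) (hB : LimAt b F B) (v : V) (w : List V) :
    MeasureTheory.Integrable fun s =>
      alongPath (geodesic a b) (ω v) s * F (geodesic a b s) w := by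
  have hc := (continuous_alongPath_geodesic hab (hω v)).mul (hF.continuous_geodesic hab w)
  have htop : (fun s => alongPath (geodesic a b) (ω v) s * F (geodesic a b s) w)
      =O[atTop] fun t => Real.exp (-1 * t) := by
    simpa using (alongPath_geodesic_isBigO_atTop hab (hω v)).mul
      ((hB.tendsto_geodesic hab w).isBigO_one ℝ)
  have hbot : (fun s => alongPath (geodesic a b) (ω v) s * F (geodesic a b s) w)
      =O[atBot] fun t => Real.exp (1 * t) := by
    simpa using (alongPath_geodesic_isBigO_atBot hab (hω v)).mul
      ((hA.tendsto_geodesic_atBot hab w).isBigO_one ℝ)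
  refine hc.locallyIntegrable.integrable_of_isBigO_atBot_atTop hbot ?_ htop ?_
  · refine ⟨Set.Iic 0, Iic_mem_atBot 0, ?_⟩
    simpa using integrableOn_exp_Iic 0
  · refine ⟨Set.Ioi 0, Ioi_mem_atTop 0, ?_⟩
    simpa using integrableOn_exp_neg_Ioi 0

/-- Fundamental theorem of calculus, inductively on the word: the limit 1 at a means that
coefficients at nonempty words start from 0. -/
theorem IsSolution.iterInt_eq (hω : ∀ v, IsCuspidal (ω v)) (hF : IsSolution ω F) (hab : a ≠ b)
    (hA : LimAt a F 1) (hB : LimAt b F B) (w : List V) (t : ℝ) :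
    iterInt (geodesic a b) ω w t = F (geodesic a b t) w := by
  induction w generalizing t with
  | nil => rw [iterInt, hF.nil _ (geodesic_im_pos hab t)]
  | cons v w ih =>
    simp only [iterInt, ih]
    rw [MeasureTheory.integral_Iic_of_hasDerivAt_of_tendsto'
      (fun s _ => hF.hasDerivAt_geodesic hab v w s)
      (hF.integrable hω hab hA hB v w).integrableOn (hA.tendsto_geodesic_atBot hab (v :: w)),
      NCSeries.one_cons, sub_zero]

theorem IsSolution.iterConverges (hω : ∀ v, IsCuspidal (ω v)) (hF : IsSolution ω F) (hab : a ≠ b)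
    (hA : LimAt a F 1) (hB : LimAt b F B) : IterConverges (geodesic a b) ω := by
  intro v w
  simp only [hF.iterInt_eq hω hab hA hB]
  exact hF.integrable hω hab hA hB v w

theorem IsSolution.iterIntFull_eq (hω : ∀ v, IsCuspidal (ω v)) (hF : IsSolution ω F)
    (hab : a ≠ b) (hA : LimAt a F 1) (hB : LimAt b F B) :
    iterIntFull (geodesic a b) ω = B := by
  funext w
  cases w with
  | nil =>
    rw [iterIntFull]
    refine tendsto_nhds_unique ?_ (hB.tendsto_geodesic hab [])
    simp only [hF.nil _ (geodesic_im_pos hab _)]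
    exact tendsto_const_nhds
  | cons v w =>
    simp only [iterIntFull, hF.iterInt_eq hω hab hA hB]
    rw [MeasureTheory.integral_of_hasDerivAt_of_tendsto
      (fun s => hF.hasDerivAt_geodesic hab v w s) (hF.integrable hω hab hA hB v w)
      (hA.tendsto_geodesic_atBot hab (v :: w)) (hB.tendsto_geodesic hab (v :: w)),
      NCSeries.one_cons, sub_zero]

end

/-! ### Composition of paths and functoriality. -/

/-- The generating series of the iterated integrals of `ω` from the cusp `a` to the cusp `b`. -/
def geodesicSeries (ω : V → ℍ → ℂ) (a b : OnePoint ℚ) : NCSeries V :=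
  iterIntFull (geodesic a b) ω

theorem iterConverges_geodesic_self (ω : V → ℍ → ℂ) (a : OnePoint ℚ) :
    IterConverges (geodesic a a) ω := by
  intro v w
  simp [alongPath, deriv_geodesic_self]

theorem geodesicSeries_self (ω : V → ℍ → ℂ) (a : OnePoint ℚ) : geodesicSeries ω a a = 1 := by
  funext w
  cases w with
  | nil => rfl
  | cons v w => simp [geodesicSeries, iterIntFull, alongPath, deriv_geodesic_self, NCSeries.one_cons]

/-- Any two solutions normalised at cusps differ by an iterated integral between the cusps. -/
theorem eq_mul_geodesicSeries {ω : V → ℍ → ℂ} (hω : ∀ v, IsCuspidal (ω v)) {F G : ℂ → NCSeries V}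
    (hF : IsSolution ω F) (hG : IsSolution ω G) {a b : OnePoint ℚ} (hFa : LimAt a F 1)
    (hGb : LimAt b G 1) :
    LimAt b F (geodesicSeries ω a b) ∧
      ∀ z, 0 < z.im → F z = G z * geodesicSeries ω a b := by
  -- Writing F = GC with G normalised at b shows at once that F has a limit at b, namely C.
  obtain ⟨C, hC⟩ := hF.exists_eq_mul hG
  have hlim : LimAt b F C := by
    have := hGb.mul_const C
    rw [one_mul] at this
    exact this.congr fun z hz => (hC z hz).symm
  have e : geodesicSeries ω a b = C := by
    by_cases hab : a = b
    · subst hab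
      rw [geodesicSeries_self]
      exact hFa.unique hlim
    · exact hF.iterIntFull_eq hω hab hFa hlim
  rw [e]
  exact ⟨hlim, hC⟩

theorem iterConverges_geodesic {ω : V → ℍ → ℂ} (hω : ∀ v, IsCuspidal (ω v))
    (a b : OnePoint ℚ) : IterConverges (geodesic a b) ω := by
  by_cases hab : a = b
  · subst hab
    exact iterConverges_geodesic_self ω a
  · obtain ⟨F, hF, hFa⟩ := exists_isSolution_limAt hω a
    obtain ⟨G, hG, hGb⟩ := exists_isSolution_limAt hω b
    exact hF.iterConverges hω hab hFa (eq_mul_geodesicSeries hω hF hG hFa hGb).1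

/-- Composition of paths. -/
theorem geodesicSeries_mul {ω : V → ℍ → ℂ} (hω : ∀ v, IsCuspidal (ω v)) (a b c : OnePoint ℚ) :
    geodesicSeries ω a c =
      geodesicSeries ω b c * geodesicSeries ω a b := by
  obtain ⟨F, hF, hFa⟩ := exists_isSolution_limAt hω a
  obtain ⟨G, hG, hGb⟩ := exists_isSolution_limAt hω b
  obtain ⟨H, hH, hHc⟩ := exists_isSolution_limAt hω c
  have h1 := (eq_mul_geodesicSeries hω hF hH hFa hHc).1
  have h2 := (eq_mul_geodesicSeries hω hF hG hFa hGb).2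
  have h3 := (eq_mul_geodesicSeries hω hG hH hGb hHc).1
  -- F equals G times the integral from a to b; both sides are read off as limits at c.
  exact h1.unique ((h3.mul_const _).congr fun z hz => (h2 z hz).symm)

/-- Functoriality of iterated integrals, if pull-back by `g` acts on the forms `ω` by a matrix. -/
theorem geodesicSeries_cuspAct [Fintype V] {ω : V → ℍ → ℂ} (hω : ∀ v, IsCuspidal (ω v))
    (g : SL(2, ℤ)) (L : V → V → ℂ)
    (hL : ∀ v z, formPullback g (ω v) z = ∑ u, L u v * ω u z) (a b : OnePoint ℚ) :
    geodesicSeries ω (cuspAct g a) (cuspAct g b) =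
      NCSeries.subst L (geodesicSeries ω a b) := by
  obtain ⟨F, hF, hFa⟩ := exists_isSolution_limAt hω a
  obtain ⟨G, hG, hGb⟩ := exists_isSolution_limAt hω b
  obtain ⟨F', hF', hFa'⟩ := exists_isSolution_limAt hω (cuspAct g a)
  obtain ⟨G', hG', hGb'⟩ := exists_isSolution_limAt hω (cuspAct g b)
  -- The series `NCSeries.subst L (F z)` and `F' (mob g z)` solve the same equation and both tend to
  -- 1 at a, so they coincide; their limits at b are the two sides.
  have h1 := hF.subst L
  have h2 := hF'.comp_mob g
  simp only [show (fun v => formPullback g (ω v)) = fun v z => ∑ u, L u v * ω u z from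
    funext fun v => funext (hL v)] at h2
  obtain ⟨C, hC⟩ := h2.exists_eq_mul h1
  have hFa1 := hFa.subst L
  rw [NCSeries.subst_one] at hFa1
  have hC1 : C = 1 := by
    have := (hFa1.mul_const C).congr fun z hz => (hC z hz).symm
    rw [one_mul] at this
    exact this.unique hFa'.comp_mob
  subst hC1
  have h3 := (eq_mul_geodesicSeries hω hF' hG' hFa' hGb').1.comp_mob
  have h4 := (eq_mul_geodesicSeries hω hF hG hFa hGb).1.subst L
  exact h3.unique (h4.congr fun z hz => by rw [hC z hz, mul_one])

/-! ### Shimura forms decay at the cusps -/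

/-- The neighbourhoods of `i∞` in the vertical strip `|re z| ≤ R`. -/
def stripFilter (R : ℝ) : Filter ℂ := comap Complex.im atTop ⊓ 𝓟 {z | |z.re| ≤ R}

theorem tendsto_im_stripFilter (R : ℝ) : Tendsto Complex.im (stripFilter R) atTop :=
  tendsto_comap.mono_left inf_le_left

theorem eventually_abs_re_le (R : ℝ) : ∀ᶠ z in stripFilter R, |z.re| ≤ R :=
  mem_inf_of_right (mem_principal_self _)

/-- The bound near i∞ leaves only a compact rectangle of the strip, where continuity bounds the
function. -/
theorem stripDecay_of_isBigO {n : ℕ} {φ : ℂ → ℂ} (hc : ContinuousOn φ {z | 0 < z.im})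
    (h : ∀ R, (fun z => φ z * (z.im : ℂ) ^ n) =O[stripFilter R] fun _ => (1 : ℝ)) :
    StripDecay n φ := by
  intro R
  obtain ⟨C, hC⟩ := (h R).bound
  rw [stripFilter, eventually_inf_principal, eventually_comap, eventually_atTop] at hC
  obtain ⟨A, hA⟩ := hC
  have hK : IsCompact (Set.Icc (-R) R ×ℂ Set.Icc 1 A) := isCompact_Icc.reProdIm isCompact_Icc
  obtain ⟨D, hD⟩ := hK.exists_bound_of_continuousOn (f := fun z => φ z * (z.im : ℂ) ^ n)
    ((hc.mono fun z hz => lt_of_lt_of_le one_pos hz.2.1).mul (by fun_prop))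
  refine ⟨max C D, fun z h1 h2 => ?_⟩
  have hy : 0 < z.im := by linarith
  have key : ‖φ z * (z.im : ℂ) ^ n‖ ≤ max C D := by
    by_cases hz : A ≤ z.im
    · exact ((hA z.im hz z rfl h2).trans (by simp)).trans (le_max_left _ _)
    · exact (hD z ⟨abs_le.mp h2, h1, (not_le.mp hz).le⟩).trans (le_max_right _ _)
  rw [norm_mul, norm_pow, Complex.norm_real, Real.norm_eq_abs, abs_of_pos hy] at key
  rwa [le_div_iff₀ (by positivity)]

theorem affine_isBigO (R : ℝ) (a b : ℂ) :
    (fun z => a * z + b) =O[stripFilter R] fun z => z.im := by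
  refine Asymptotics.IsBigO.of_bound (‖a‖ * (R + 1) + ‖b‖) ?_
  filter_upwards [eventually_abs_re_le R,
    (tendsto_im_stripFilter R).eventually_ge_atTop 1] with z h1 h2
  have hR : 0 ≤ R := (abs_nonneg _).trans h1
  have hy : |z.im| = z.im := abs_of_pos (by linarith)
  have hz : ‖z‖ ≤ (R + 1) * z.im := by
    have := Complex.norm_le_abs_re_add_abs_im z
    rw [hy] at this
    nlinarith
  rw [Real.norm_eq_abs, hy]
  calc ‖a * z + b‖ ≤ ‖a‖ * ‖z‖ + ‖b‖ := (norm_add_le _ _).trans (by rw [norm_mul])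
    _ ≤ ‖a‖ * ((R + 1) * z.im) + ‖b‖ * z.im := by
      gcongr
      exact le_mul_of_one_le_right (norm_nonneg _) h2
    _ = (‖a‖ * (R + 1) + ‖b‖) * z.im := by ring

/-- Some polynomial growth rate is enough, since exponential decay will absorb it. -/
theorem eval_isBigO {σ : Type*} (R : ℝ) {x : ℂ → σ → ℂ}
    (hx : ∀ i, (fun z => x z i) =O[stripFilter R] fun z => z.im) (P : MvPolynomial σ ℂ) :
    ∃ N : ℕ, (fun z => MvPolynomial.eval (x z) P) =O[stripFilter R] fun z => z.im ^ N := by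
  induction P using MvPolynomial.induction_on with
  | C c => exact ⟨0, by
      simpa using Asymptotics.isBigO_const_const c (one_ne_zero (α := ℝ)) (stripFilter R)⟩
  | add p q hp hq =>
    obtain ⟨M, hM⟩ := hp
    obtain ⟨N, hN⟩ := hq
    have mono : ∀ m n : ℕ, m ≤ n →
        (fun z : ℂ => z.im ^ m) =O[stripFilter R] fun z : ℂ => z.im ^ n := by
      intro m n hmn
      refine Asymptotics.IsBigO.of_bound 1 ?_
      filter_upwards [(tendsto_im_stripFilter R).eventually_ge_atTop 1] with z hz
      have h0 : (0 : ℝ) ≤ z.im := by linarith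
      rw [one_mul, Real.norm_of_nonneg (pow_nonneg h0 _), Real.norm_of_nonneg (pow_nonneg h0 _)]
      exact pow_le_pow_right₀ hz hmn
    refine ⟨max M N, ?_⟩
    simp only [map_add]
    exact (hM.trans (mono _ _ (le_max_left _ _))).add (hN.trans (mono _ _ (le_max_right _ _)))
  | mul_X p i hp =>
    obtain ⟨N, hN⟩ := hp
    refine ⟨N + 1, ?_⟩
    simpa only [map_mul, MvPolynomial.eval_X, pow_succ] using hN.mul (hx i)

theorem differentiable_eval {σ : Type*} {x : ℂ → σ → ℂ}
    (hx : ∀ i, Differentiable ℂ fun z => x z i) (P : MvPolynomial σ ℂ) :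
    Differentiable ℂ fun z => MvPolynomial.eval (x z) P := by
  induction P using MvPolynomial.induction_on with
  | C c => simp
  | add p q hp hq => simp only [map_add]; exact hp.add hq
  | mul_X p i hp => simp only [map_mul, MvPolynomial.eval_X]; exact hp.mul (hx i)

-- The translate f|g is a cusp form for the conjugate group g⁻¹Γg, which is again arithmetic, and a
-- cusp form decays exponentially at ∞.
open scoped Pointwise in
theorem slash_isBigO {Γ : Subgroup SL(2, ℤ)} [Γ.FiniteIndex] {k : ℤ}
    (f : CuspForm (Γ : Subgroup (GL (Fin 2) ℝ)) k) (g : SL(2, ℤ)) :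
    ∃ c > 0, (fun z : ℍ => f (g • z) *
      (((g 1 0 : ℤ) : ℂ) * (z : ℂ) + ((g 1 1 : ℤ) : ℂ)) ^ (-k)) =O[UpperHalfPlane.atImInfty]
        fun z => Real.exp (-c * z.im) := by
  have : ((ConjAct.toConjAct (g : GL (Fin 2) ℝ)⁻¹) •
      (Γ : Subgroup (GL (Fin 2) ℝ))).IsArithmetic := by
    simpa [(show Rat.castHom ℝ = algebraMap ℚ ℝ by rfl), map_inv, Matrix.SpecialLinearGroup.map_mapGL]
      using! Subgroup.IsArithmetic.conj (Γ : Subgroup (GL (Fin 2) ℝ))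
        (Matrix.SpecialLinearGroup.mapGL ℚ g)⁻¹
  have hz := CuspFormClass.zero_at_infty (CuspForm.translate f g)
  obtain ⟨c, hc, h⟩ := ModularFormClass.exp_decay_atImInfty' (CuspForm.translate f g) hz
  refine ⟨c, hc, h.congr_left fun z => ?_⟩
  rw [CuspForm.coe_translate, ModularForm.SL_slash_apply, ModularGroup.denom_apply]

/-- By homogeneity the pull-back by g has coefficient (f|g)(z) P(az + b, cz + d): the powers k - 2
from P and 2 from dz combine into weight k. Exponential decay beats the polynomial. -/
theorem isCuspidal_of_cuspForm {Γ : Subgroup SL(2, ℤ)} [Γ.FiniteIndex] {k : ℕ} (hk : 2 ≤ k)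
    (f : CuspForm (Γ : Subgroup (GL (Fin 2) ℝ)) (k : ℤ)) {P : MvPolynomial (Fin 2) ℂ}
    (hP : P.IsHomogeneous (k - 2)) :
    IsCuspidal fun z : ℍ => f z * MvPolynomial.eval ![(z : ℂ), 1] P := by
  have holo : DifferentiableOn ℂ (fun z => (fun z : ℍ => f z *
      MvPolynomial.eval ![(z : ℂ), 1] P) (UpperHalfPlane.ofComplex z)) {z | 0 < z.im} := by
    have h1 := UpperHalfPlane.mdifferentiable_iff.mp (CuspFormClass.holo f)
    have h2 : Differentiable ℂ fun z : ℂ => MvPolynomial.eval ![z, 1] P :=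
      differentiable_eval (fun i => by fin_cases i <;> simp) P
    refine (h1.mul h2.differentiableOn).congr fun z hz => ?_
    simp only [Function.comp, Pi.mul_apply]
    rw [coe_ofComplex hz]
  refine ⟨holo, fun g => stripDecay_of_isBigO
    (differentiableOn_formPullback holo g).continuousOn fun R => ?_⟩
  obtain ⟨c, hc, hf⟩ := slash_isBigO f g
  obtain ⟨N, hN⟩ := eval_isBigO R
    (x := fun z => ![((g 0 0 : ℤ) : ℂ) * z + ((g 0 1 : ℤ) : ℂ),
      ((g 1 0 : ℤ) : ℂ) * z + ((g 1 1 : ℤ) : ℂ)])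
    (fun i => by fin_cases i <;> exact affine_isBigO R _ _) P
  have hof : Tendsto UpperHalfPlane.ofComplex (stripFilter R) UpperHalfPlane.atImInfty :=
    UpperHalfPlane.tendsto_comap_im_ofComplex.mono_left inf_le_left
  have hpos : ∀ᶠ z in stripFilter R, 0 < z.im :=
    (tendsto_im_stripFilter R).eventually_gt_atTop 0
  have h1 := hf.comp_tendsto hof
  have h2 : (fun z : ℂ => (z.im : ℂ) ^ 2) =O[stripFilter R] fun z => z.im ^ 2 := by
    refine Asymptotics.IsBigO.of_bound 1 (Eventually.of_forall fun z => ?_)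
    simp
  have h3 := (h1.mul hN).mul h2
  have h4 : (fun z : ℂ => Real.exp (-c * z.im) * z.im ^ N * z.im ^ 2) =O[stripFilter R]
      fun _ => (1 : ℝ) := by
    -- The exponent N + 2 collects the growth of P and the factor y² demanded by `StripDecay 2`.
    have := ((isLittleO_pow_exp_pos_mul_atTop (k := N + 2) hc).isBigO.comp_tendsto
      (tendsto_im_stripFilter R))
    refine (((Asymptotics.isBigO_refl (fun z : ℂ => Real.exp (-c * z.im)) _).mul this).congr
      (fun z => ?_) (fun z => ?_))
    · simp only [Function.comp]
      ring
    · simp only [Function.comp]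
      rw [← Real.exp_add]
      simp
  refine (h3.congr' ?_ ?_).trans h4
  · filter_upwards [hpos] with z hz
    congr 1
    have hd := denom_ne_zero g hz
    have key := eval_mul_of_isHomogeneous hP
      (((g 1 0 : ℤ) : ℂ) * z + ((g 1 1 : ℤ) : ℂ)) ![mob g z, 1]
    have hvec : (fun i => (((g 1 0 : ℤ) : ℂ) * z + ((g 1 1 : ℤ) : ℂ)) * ![mob g z, 1] i) =
        ![((g 0 0 : ℤ) : ℂ) * z + ((g 0 1 : ℤ) : ℂ), ((g 1 0 : ℤ) : ℂ) * z + ((g 1 1 : ℤ) : ℂ)] := by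
      funext i
      fin_cases i
      · simp [mob, mul_div_cancel₀ _ hd]
      · simp
    rw [hvec] at key
    simp only [Function.comp, key, formPullback_apply, coe_smul_eq_mob]
    rw [coe_ofComplex hz, ← zpow_natCast _ (k - 2), Nat.cast_sub hk]
    generalize ((g 1 0 : ℤ) : ℂ) * z + ((g 1 1 : ℤ) : ℂ) = j at *
    rw [zpow_sub₀ hd, zpow_neg, zpow_neg]
    have := zpow_ne_zero (k : ℤ) hd
    push_cast
    field_simp
  · filter_upwards [hpos] with z hz
    simp only [Function.comp]
    rw [← UpperHalfPlane.coe_im, coe_ofComplex hz]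

theorem isCuspidal_zero : IsCuspidal 0 where
  holo := differentiableOn_const 0
  decay g R := ⟨0, fun z _ _ => by simp⟩

theorem IsCuspidal.add {h₁ h₂ : ℍ → ℂ} (H₁ : IsCuspidal h₁) (H₂ : IsCuspidal h₂) :
    IsCuspidal (h₁ + h₂) where
  holo := H₁.holo.add H₂.holo
  decay g R := by
    obtain ⟨C, hC⟩ := H₁.decay g R
    obtain ⟨D, hD⟩ := H₂.decay g R
    refine ⟨C + D, fun z h1 h2 => ?_⟩
    rw [map_add, add_div]
    exact (norm_add_le _ _).trans (add_le_add (hC z h1 h2) (hD z h1 h2))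

theorem IsCuspidal.smul (a : ℂ) {h : ℍ → ℂ} (H : IsCuspidal h) : IsCuspidal (a • h) where
  holo := H.holo.const_smul a
  decay g R := by
    obtain ⟨C, hC⟩ := H.decay g R
    refine ⟨‖a‖ * C, fun z h1 h2 => ?_⟩
    rw [map_smul, mul_div_assoc]
    change ‖a • ManinShimura.formPullback g h _‖ ≤ _
    rw [norm_smul]
    exact mul_le_mul_of_nonneg_left (hC z h1 h2) (norm_nonneg a)

theorem isCuspidal_of_mem_shimuraForms {Γ : Subgroup SL(2, ℤ)} [Γ.FiniteIndex] {k : ℕ}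
    (hk : 2 ≤ k) {h : ℍ → ℂ} (hh : h ∈ shimuraForms Γ k) : IsCuspidal h := by
  induction hh using Submodule.span_induction with
  | zero => exact isCuspidal_zero
  | add x y _ _ hx hy => exact hx.add hy
  | smul a x _ hx => exact hx.smul a
  | mem x hx =>
    obtain ⟨f, P, hP, rfl⟩ := hx
    exact isCuspidal_of_cuspForm hk f hP

section

variable {Γ : Subgroup SL(2, ℤ)} {K : Finset ℕ}

theorem toForm_of (k : K) (h : shimuraForms Γ (k : ℕ)) :
    toForm Γ K (DirectSum.of (fun k : K => shimuraForms Γ (k : ℕ)) k h) = h :=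
  DirectSum.coeLinearMap_of (fun k : K => shimuraForms Γ (k : ℕ)) k h

theorem isCuspidal_toForm [Γ.FiniteIndex] (hK : ∀ k ∈ K, 2 ≤ k) (x : ShimuraSpace Γ K) :
    IsCuspidal (toForm Γ K x) := by
  induction x using DirectSum.induction_on with
  | zero => rw [map_zero]; exact isCuspidal_zero
  | of k h =>
    rw [toForm_of]
    exact isCuspidal_of_mem_shimuraForms (hK k k.2) h.2
  | add x y hx hy => rw [map_add]; exact hx.add hy

theorem toForm_pullback (hK : ∀ k ∈ K, 2 ≤ k) (γ : Γ) (x : ShimuraSpace Γ K) :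
    toForm Γ K (pullback Γ K hK γ x) = formPullback (γ : SL(2, ℤ)) (toForm Γ K x) := by
  induction x using DirectSum.induction_on with
  | zero => simp only [map_zero]
  | of k h =>
    have h2 : pullback Γ K hK γ (DirectSum.of _ k h) = DirectSum.of
        (fun k : K => shimuraForms Γ (k : ℕ)) k
        ((formPullback (γ : SL(2, ℤ))).restrict (formPullback_mem Γ (hK k k.2) γ) h) :=
      DirectSum.lmap_lof _ _ _
    rw [h2, toForm_of, toForm_of]
    rfl
  | add x y hx hy => simp only [map_add, hx, hy]

variable (ω : Module.Basis V ℂ (ShimuraSpace Γ K))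

theorem isCuspidal_basisForms [Γ.FiniteIndex] (hK : ∀ k ∈ K, 2 ≤ k) (v : V) :
    IsCuspidal (basisForms ω v) :=
  isCuspidal_toForm hK _

/-- The A_u-coordinate of γ^*ω_v is ⟨ω_v, γ_*A_u⟩, so the matrix of the pull-back is the one used in
`seriesAction`. -/
theorem formPullback_basisForms [Fintype V] (hK : ∀ k ∈ K, 2 ≤ k) (γ : Γ) (v : V) (z : ℍ) :
    formPullback (γ : SL(2, ℤ)) (basisForms ω v) z =
      ∑ u, pushforward Γ K hK γ (ω.coord u) (ω v) * basisForms ω u z := by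
  rw [basisForms, ← toForm_pullback hK]
  conv_lhs => rw [← ω.sum_repr (pullback Γ K hK γ (ω v)), map_sum]
  simp only [map_smul, Finset.sum_apply, Pi.smul_apply, smul_eq_mul]
  rfl

/-! ### Monomials in primitive integrals -/

theorem J_self (a : OnePoint ℚ) : J ω a a = 1 := geodesicSeries_self _ a

theorem J_mul [Γ.FiniteIndex] (hK : ∀ k ∈ K, 2 ≤ k) (a b c : OnePoint ℚ) :
    J ω a c = J ω b c * J ω a b :=
  geodesicSeries_mul (isCuspidal_basisForms ω hK) a b c

theorem J_cuspAct [Γ.FiniteIndex] [Fintype V] (hK : ∀ k ∈ K, 2 ≤ k) (γ : Γ) (a b : OnePoint ℚ) :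
    J ω (cuspAct γ a) (cuspAct γ b) = seriesAction hK ω γ (J ω a b) :=
  geodesicSeries_cuspAct (isCuspidal_basisForms ω hK) γ _ (formPullback_basisForms ω hK γ) a b

variable [Fintype V] {ω} {C : Set (Matrix.ProjectiveSpecialLinearGroup (Fin 2) ℤ)}
  {hK : ∀ k ∈ K, 2 ≤ k}

theorem IsPrimitiveMonomial.mul {x y : NCSeries V} (hx : IsPrimitiveMonomial hK ω C x)
    (hy : IsPrimitiveMonomial hK ω C y) : IsPrimitiveMonomial hK ω C (x * y) := by
  obtain ⟨l, hl, rfl⟩ := hx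
  obtain ⟨m, hm, rfl⟩ := hy
  refine ⟨l ++ m, fun z hz => ?_, List.prod_append.symm⟩
  rcases List.mem_append.mp hz with h | h
  · exact hl z h
  · exact hm z h

variable (ω hK)

/-- Lift the decomposition of the class of g to g = γdz with d over C and z central. As z moves no
cusp, equivariance under γ gives a monomial of length one. -/
theorem isPrimitiveMonomial_infty_zero [Γ.FiniteIndex] (hC : IsRepresentatives Γ C)
    (g : SL(2, ℤ)) :
    IsPrimitiveMonomial hK ω C (J ω (cuspAct g ∞) (cuspAct g ((0 : ℚ) : OnePoint ℚ))) := by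
  obtain ⟨⟨p, c⟩, hmul, -⟩ :=
    hC.existsUnique (QuotientGroup.mk' (Subgroup.center SL(2, ℤ)) g)
  obtain ⟨γ, hγ, hp⟩ := p.2
  obtain ⟨d, hd⟩ := QuotientGroup.mk'_surjective (Subgroup.center SL(2, ℤ)) c.1
  have hmk : QuotientGroup.mk' (Subgroup.center SL(2, ℤ)) (γ * d) =
      QuotientGroup.mk' (Subgroup.center SL(2, ℤ)) g := by
    rw [map_mul, hd, hp]
    exact hmul
  obtain ⟨z, hz, rfl⟩ := (QuotientGroup.mk'_eq_mk' _).mp hmk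
  have hact : ∀ x, cuspAct (γ * d * z) x = cuspAct γ (cuspAct d x) := fun x => by
    rw [cuspAct_mul, cuspAct_of_mem_center hz, cuspAct_mul]
  rw [hact, hact]
  refine ⟨[J ω (cuspAct γ (cuspAct d ∞)) (cuspAct γ (cuspAct d ((0 : ℚ) : OnePoint ℚ)))],
    fun y hy => ⟨⟨γ, hγ⟩, _, ⟨d, hd ▸ c.2, Or.inl rfl⟩, ?_⟩, List.prod_singleton.symm⟩
  rw [List.mem_singleton.mp hy]
  exact J_cuspAct ω hK ⟨γ, hγ⟩ _ _

theorem isPrimitiveMonomial_J [Γ.FiniteIndex] (hC : IsRepresentatives Γ C) (a b : OnePoint ℚ) :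
    IsPrimitiveMonomial hK ω C (J ω a b) := by
  have trans : ∀ {a b c : OnePoint ℚ}, IsPrimitiveMonomial hK ω C (J ω a b) →
      IsPrimitiveMonomial hK ω C (J ω b c) → IsPrimitiveMonomial hK ω C (J ω a c) := by
    intro a b c h1 h2
    rw [J_mul ω hK a b c]
    exact h2.mul h1
  have refl : ∀ a, IsPrimitiveMonomial hK ω C (J ω a a) := fun a =>
    ⟨[], by simp, by rw [J_self, List.prod_nil]⟩
  -- The base g stays universally quantified so that a product can be handled by moving the base
  -- from g to gx; both directions are kept so that an inverse merely swaps them.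
  have key : ∀ h : SL(2, ℤ), ∀ g : SL(2, ℤ),
      IsPrimitiveMonomial hK ω C (J ω (cuspAct g ∞) (cuspAct (g * h) ∞)) ∧
      IsPrimitiveMonomial hK ω C (J ω (cuspAct (g * h) ∞) (cuspAct g ∞)) := by
    intro h
    have hmem : h ∈ Subgroup.closure {ModularGroup.S, ModularGroup.T} := by
      rw [SpecialLinearGroup.SL2Z_generators]
      exact Subgroup.mem_top h
    induction hmem using Subgroup.closure_induction with
    | mem x hx =>
      intro g
      rcases hx with rfl | rfl
      · rw [cuspAct_mul, cuspAct_S_infty]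
        refine ⟨isPrimitiveMonomial_infty_zero ω hK hC g, ?_⟩
        -- S exchanges ∞ and 0, so the edge of gS is the edge of g reversed.
        have := isPrimitiveMonomial_infty_zero ω hK hC (g * ModularGroup.S)
        rwa [cuspAct_mul, cuspAct_mul, cuspAct_S_infty, cuspAct_S_zero] at this
      · rw [cuspAct_mul, cuspAct_T_infty]
        exact ⟨refl _, refl _⟩
    | one => intro g; rw [mul_one]; exact ⟨refl _, refl _⟩
    | mul x y _ _ hx hy =>
      intro g
      rw [← mul_assoc]
      exact ⟨trans (hx g).1 (hy (g * x)).1, trans (hy (g * x)).2 (hx g).2⟩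
    | inv x _ hx =>
      intro g
      have := hx (g * x⁻¹)
      rw [inv_mul_cancel_right] at this
      exact this.symm
  obtain ⟨g, rfl⟩ := exists_cuspAct_infty a
  obtain ⟨g', rfl⟩ := exists_cuspAct_infty b
  simpa using (key (g⁻¹ * g') g).1

end

end ManinShimura

end

theorem proposition2p5p2 (Γ : Subgroup (Matrix.SpecialLinearGroup (Fin 2) ℤ)) [Γ.FiniteIndex]
    (K : Finset ℕ) (hK : ∀ k ∈ K, 2 ≤ k) {V : Type*} [Fintype V]
    (ω : Module.Basis V ℂ (ManinShimura.ShimuraSpace Γ K))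
    (C : Set (Matrix.ProjectiveSpecialLinearGroup (Fin 2) ℤ))
    (hC : ManinShimura.IsRepresentatives Γ C) :
    (∀ a b : OnePoint ℚ,
      ManinShimura.IterConverges (ManinShimura.geodesic a b) (ManinShimura.basisForms ω)) ∧
    (∀ a b : OnePoint ℚ,
      ManinShimura.IsPrimitiveMonomial hK ω C (ManinShimura.J ω b a)) ∧
    (∀ (a : OnePoint ℚ) (γ : Γ),
      ManinShimura.IsPrimitiveMonomial hK ω C
        (ManinShimura.J ω (ManinShimura.cuspAct γ a) a)) :=
  ⟨ManinShimura.iterConverges_geodesic (ManinShimura.isCuspidal_basisForms ω hK),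
    fun a b => ManinShimura.isPrimitiveMonomial_J ω hK hC b a,
    fun a γ => ManinShimura.isPrimitiveMonomial_J ω hK hC (ManinShimura.cuspAct γ a) a⟩
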